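/- Theorem. Let $M=\mathbb{R}^n/\Gamma$ be a closed flat manifold, where $\Gamma=\pi_1(M)$ is a discrete, torsion-free, cocompact subgroup of $\mathrm{Isom}(\mathbb{R}^n)=O(n)\ltimes\mathbb{R}^n$. Let $G\subset O(n)$ be its holonomy group, i.e. the image of the projection $p\colon\Gamma\to O(n)$ to linear parts, let $\mathbb{Z}^n\cong\ker p$ be the lattice of translations in $\Gamma$, and let $\rho\colon G\to \mathrm{GL}(n,\mathbb{Z})$ be the holonomy representation, $\rho(g)(e)=\tilde g e\tilde g^{-1}$ for $e\in\ker p$ and any $\tilde g\in\Gamma$ with $p(\tilde g)=g$. Suppose that $G$ is solvable and that $\rho$, considered over $\mathbb{Q}$, has a non-trivial $\mathbb{Q}$-irreducible subrepresentation $\rho'$ of odd dimension (non-trivial meaning $\rho'(G)\neq\{1\}$) such that $\rho'(G)$ is not $\mathbb{Q}$-conjugate to $\tilde\rho(G)$ for any other $\mathbb{Q}$-subrepresentation $\tilde\rho$ of $\rho$; that is, if $V'\subset\mathbb{Q}^n$ is the invariant subspace carrying $\rho'$, then for every invariant subspace $W\neq V'$ of $\mathbb{Q}^n$, carrying $\tilde\rho$,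 there is no $\mathbb{Q}$-linear isomorphism $\varphi\colon V'\to W$ with $\varphi\,\rho'(G)\,\varphi^{-1}=\tilde\rho(G)$. Then $M$ has the $R_\infty$ property: for every homeomorphism $f\colon M\to M$ the Reidemeister number $R(f)$, i.e. the number of classes of $\Gamma=\pi_1(M)$ under the relation $\alpha\sim\gamma\alpha f_\sharp(\gamma)^{-1}$ $(\gamma\in\Gamma)$, where $f_\sharp$ is the endomorphism of $\pi_1(M)$ induced by $f$, is infinite. -/

import Mathlib

/-- Euclidean space `ℝⁿ`. -/
abbrev Euc (n : ℕ) : Type := EuclideanSpace ℝ (Fin n)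

/-- The group `Isom(ℝⁿ) = O(n) ⋉ ℝⁿ` of isometries of Euclidean space. -/
abbrev EucIsom (n : ℕ) : Type := Euc n ≃ᵃⁱ[ℝ] Euc n

namespace EucIsom

variable {n : ℕ}

/-- The projection `Isom(ℝⁿ) → O(n)` to the linear part. -/
noncomputable def linearPart : EucIsom n →* (Euc n ≃ₗᵢ[ℝ] Euc n) where
  toFun γ := γ.linearIsometryEquiv
  map_one' := rfl
  map_mul' _ _ := rfl

/-- The translation `x ↦ v + x`. -/
noncomputable def translation (v : Euc n) : EucIsom n :=
  AffineIsometryEquiv.constVAdd ℝ (Euc n) v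

@[simp]
theorem translation_apply (v x : Euc n) : translation v x = v + x := rfl

/-- The tautological action of `Isom(ℝⁿ)` on `ℝⁿ`. -/
noncomputable instance instMulAction : MulAction (EucIsom n) (Euc n) where
  smul γ x := γ x
  one_smul _ := rfl
  mul_smul _ _ _ := rfl

/-- The topology of `Isom(ℝⁿ) = O(n) ⋉ ℝⁿ`, the one of the product `O(n) × ℝⁿ`. -/
noncomputable instance instTopologicalSpace : TopologicalSpace (EucIsom n) :=
  TopologicalSpace.induced
    (fun γ => (((linearPart γ : Euc n ≃L[ℝ] Euc n) : Euc n →L[ℝ] Euc n), γ 0))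
    inferInstance

/-- Conjugating a translation by `γ` applies the linear part of `γ` to the translation vector. -/
theorem conj_translation (γ : EucIsom n) (v : Euc n) :
    γ * translation v * γ⁻¹ = translation (linearPart γ v) := by
  ext1 x
  change γ (v +ᵥ (γ⁻¹ : EucIsom n) x) = linearPart γ v +ᵥ x
  rw [AffineIsometryEquiv.map_vadd]
  change linearPart γ v +ᵥ (γ * γ⁻¹) x = _
  rw [mul_inv_cancel]
  rfl

end EucIsom

open EucIsom in
/-- A Bieberbach group of dimension `n`: a discrete, torsion-free and cocompact subgroup of
`Isom(ℝⁿ)`. -/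
structure IsBieberbach {n : ℕ} (Γ : Subgroup (EucIsom n)) : Prop where
  discrete : DiscreteTopology Γ
  torsionFree : ∀ γ ∈ Γ, IsOfFinOrder γ → γ = 1
  cocompact : CompactSpace (MulAction.orbitRel.Quotient Γ (Euc n))

namespace Bieberbach

open EucIsom

variable {n : ℕ}

/-- The lattice of translations in `Γ`: all vectors `v` with `(x ↦ v + x) ∈ Γ`. It is isomorphic
to the subgroup of translations of `Γ`. -/
noncomputable def lattice (Γ : Subgroup (EucIsom n)) : AddSubgroup (Euc n) where
  carrier := {v | translation v ∈ Γ}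
  zero_mem' := by
    have : translation (0 : Euc n) = 1 := by ext1 x; simp
    simp [this, Γ.one_mem]
  add_mem' {v w} hv hw := by
    have : translation (v + w) = translation v * translation w := by
      ext1 x
      change v + w + x = v + (w + x)
      rw [add_assoc]
    simpa [this] using Γ.mul_mem hv hw
  neg_mem' {v} hv := by
    have : translation (-v) = (translation v)⁻¹ := by
      rw [eq_inv_iff_mul_eq_one]
      ext1 x
      change -v + (v + x) = x
      simp
    simpa [this] using Γ.inv_mem hv

/-- The holonomy group `G` of `Γ`: the image of `Γ` in `O(n)`. The kernel of `Γ → G` is the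
subgroup of translations of `Γ`. -/
noncomputable def holonomyGroup (Γ : Subgroup (EucIsom n)) : Subgroup (Euc n ≃ₗᵢ[ℝ] Euc n) :=
  Γ.map linearPart

theorem apply_mem_lattice (Γ : Subgroup (EucIsom n)) (g : holonomyGroup Γ) {v : Euc n}
    (hv : v ∈ lattice Γ) : (g : Euc n ≃ₗᵢ[ℝ] Euc n) v ∈ lattice Γ := by
  obtain ⟨_, γ, hγ, rfl⟩ := g
  change translation (linearPart γ v) ∈ Γ
  rw [← conj_translation]
  exact Γ.mul_mem (Γ.mul_mem hγ hv) (Γ.inv_mem hγ)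

/-- The integral holonomy representation `ρ : G → GL(ℤⁿ)`, where `ℤⁿ` is the translation lattice
of `Γ`. By `holonomyRep_conj` it is given by conjugating translations by lifts to `Γ`. -/
noncomputable def holonomyRep (Γ : Subgroup (EucIsom n)) :
    Representation ℤ (holonomyGroup Γ) (lattice Γ) where
  toFun g := AddMonoidHom.toIntLinearMap
    { toFun := fun v => ⟨(g : Euc n ≃ₗᵢ[ℝ] Euc n) v, apply_mem_lattice Γ g v.2⟩
      map_zero' := by ext1; simp
      map_add' := fun v w => by ext1; simp }
  map_one' := rfl
  map_mul' _ _ := rfl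

theorem holonomyRep_conj (Γ : Subgroup (EucIsom n)) (γ : EucIsom n) (hγ : γ ∈ Γ)
    (v : lattice Γ) :
    translation (holonomyRep Γ ⟨linearPart γ, γ, hγ, rfl⟩ v : Euc n) =
      γ * translation (v : Euc n) * γ⁻¹ :=
  (conj_translation γ v).symm

/-- The rational holonomy representation: the integral one with scalars extended to `ℚ`. -/
noncomputable def rationalHolonomyRep (Γ : Subgroup (EucIsom n)) :
    Representation ℚ (holonomyGroup Γ) (TensorProduct ℤ ℚ (lattice Γ)) :=
  (Module.End.baseChangeHom ℤ ℚ (lattice Γ) :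
    Module.End ℤ (lattice Γ) →* Module.End ℚ (TensorProduct ℤ ℚ (lattice Γ))).comp
    (holonomyRep Γ)

end Bieberbach

/-- The images `ρ₁(G)` and `ρ₂(G)` are conjugate over `k`: some `k`-linear isomorphism `φ` of the
underlying spaces satisfies `φ ρ₁(G) φ⁻¹ = ρ₂(G)` (an equality of sets of endomorphisms). -/
def Representation.ImagesConjugate {k G V W : Type*} [CommSemiring k] [Monoid G]
    [AddCommMonoid V] [Module k V] [AddCommMonoid W] [Module k W]
    (ρ₁ : Representation k G V) (ρ₂ : Representation k G W) : Prop :=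
  ∃ φ : V ≃ₗ[k] W, φ.conj '' Set.range ρ₁ = Set.range ρ₂

section Reidemeister

/-- `α` and `β` are `φ`-conjugate if `β = γ α φ(γ)⁻¹` for some `γ`. -/
def reidemeisterSetoid {π : Type*} [Group π] (φ : π →* π) : Setoid π where
  r α β := ∃ γ, β = γ * α * (φ γ)⁻¹
  iseqv :=
    { refl := fun α => ⟨1, by simp⟩
      symm := by
        rintro α β ⟨γ, rfl⟩
        exact ⟨γ⁻¹, by simp [mul_assoc]⟩
      trans := by
        rintro α β δ ⟨γ, rfl⟩ ⟨γ', rfl⟩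
        exact ⟨γ' * γ, by simp [mul_assoc]⟩ }

/-- The Reidemeister number `R(φ)`: the number of `φ`-conjugacy classes. -/
noncomputable def reidemeisterNumber {π : Type*} [Group π] (φ : π →* π) : ℕ∞ :=
  ENat.card (Quotient (reidemeisterSetoid φ))

/-- The endomorphism `f_♯` of `π₁(M, x)` induced by a map `f`, where `π₁(M, f x)` is identified
with `π₁(M, x)` along a path `w` from `f x` to `x`. -/
noncomputable def inducedEnd {M : Type*} [TopologicalSpace M] (f : C(M, M)) (x : M)
    (w : Path (f x) x) : FundamentalGroup M x →* FundamentalGroup M x :=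
  (FundamentalGroup.fundamentalGroupMulEquivOfPath w).toMonoidHom.comp
    (FundamentalGroup.map f x)

/-- The `R_∞` property of a path connected space `M`: the Reidemeister number of every
homeomorphism of `M` is infinite (for all choices of the base point and the path that define
`f_♯`). -/
def HasRInfinity (M : Type*) [TopologicalSpace M] : Prop :=
  ∀ (f : M ≃ₜ M) (x : M) (w : Path (f x) x),
    reidemeisterNumber (inducedEnd (f : C(M, M)) x w) = ⊤

end Reidemeister

/-! A homeomorphism induces an automorphism `φ` of `Γ`. Translations are exactly the elements with
finite conjugacy class, so `φ` restricts to the lattice and induces a rational automorphism `A`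
normalizing the finite group `K = ρ(G)`. Since `A V'` carries an image conjugate to `ρ'(G)`, the
hypothesis on `ρ'` forces `A V' = V'`.

The heart is `LinearEquiv.exists_mul_apply_eq_self`: some `k * A` with `k ∈ K` fixes a non-zero
vector of `V'`. It is an induction on dimension by Clifford theory. The last derived subgroup `D` of
`K` acting non-trivially acts through commuting maps of finite order, so odd dimension yields an
odd-dimensional joint eigenspace with a sign weight `χ`. If it is proper, pass to it, to the
stabilizer of `χ` in `K`, and to an element of `K * A` fixing `χ`. Otherwise `D` acts by signs, with
some `d ∈ D` acting as `-1`. Determinants rule this out when `D ≤ ⁅K, K⁆`. When `D = K` the space is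
a line, on which `A` is `±1` because it preserves a lattice, and `d` corrects the sign.

Composing `φ` with an inner automorphism does not affect infinitude of the Reidemeister number, so
the resulting `ψ` may be assumed to fix a non-trivial translation. Such a fixed element produces a
non-zero `ψ`-invariant homomorphism to `ℝ` on a finite-index subgroup. Finitely many Reidemeister
classes would leave that homomorphism only finitely many values, which is impossible. -/

/-! ### Eigenvalues of finite-order maps in odd dimension -/

/-- A monic real polynomial of odd degree has a root. -/
theorem Polynomial.Monic.exists_isRoot_of_odd_natDegree {p : Polynomial ℝ} (hp : p.Monic)
    (hodd : Odd p.natDegree) : ∃ r, p.IsRoot r := by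
  have hpos : 0 < p.natDegree := hodd.pos
  have h1 : Filter.Tendsto (fun x => p.eval x) Filter.atTop Filter.atTop :=
    p.tendsto_atTop_of_leadingCoeff_nonneg (natDegree_pos_iff_degree_pos.1 hpos)
      (by rw [hp.leadingCoeff]; exact zero_le_one)
  have hdeg : (p.comp (-X)).natDegree = p.natDegree := by rw [natDegree_comp]; simp
  have hlead : (p.comp (-X)).leadingCoeff = -1 := by
    rw [leadingCoeff_comp (by simp), hp.leadingCoeff]
    simp [hodd.neg_one_pow]
  have h2 : Filter.Tendsto (fun x => (p.comp (-X)).eval x) Filter.atTop Filter.atBot :=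
    (p.comp (-X)).tendsto_atBot_of_leadingCoeff_nonpos
      (natDegree_pos_iff_degree_pos.1 (hdeg ▸ hpos)) (by rw [hlead]; norm_num)
  obtain ⟨a, ha⟩ := (h1.eventually_ge_atTop 0).exists
  obtain ⟨b, hb⟩ := (h2.eventually_le_atBot 0).exists
  exact mem_range_of_exists_le_of_exists_ge p.continuous ⟨-b, by simpa using hb⟩ ⟨a, ha⟩

namespace Module.End

/-- An endomorphism of finite order of an odd-dimensional rational vector space has `1` or `-1` as
an eigenvalue. -/
theorem exists_apply_eq_or_neg_of_odd_finrank {W : Type*} [AddCommGroup W] [Module ℚ W]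
    [FiniteDimensional ℚ W] {f : Module.End ℚ W} {N : ℕ} (hN : N ≠ 0) (hf : f ^ N = 1)
    (hodd : Odd (Module.finrank ℚ W)) : ∃ w ≠ 0, f w = w ∨ f w = -w := by
  -- Odd degree gives a real eigenvalue `r`; finite order makes it `±1`, which is rational, so the
  -- eigenvector can be found over `ℚ`.
  have hdeg : Odd (f.baseChange ℝ).charpoly.natDegree := by
    rw [LinearMap.charpoly_natDegree, Module.finrank_baseChange]; exact hodd
  obtain ⟨r, hr⟩ := (LinearMap.charpoly_monic _).exists_isRoot_of_odd_natDegree hdeg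
  have hev := (Module.End.hasEigenvalue_iff_isRoot_charpoly (f.baseChange ℝ) r).2 hr
  have hrN : r ^ N = 1 := by
    have h2 : (f.baseChange ℝ) ^ N = 1 := by
      rw [← LinearMap.baseChange_pow, hf, Module.End.one_eq_id, LinearMap.baseChange_id,
        Module.End.one_eq_id]
    obtain ⟨q, hq⟩ := minpoly.dvd ℝ (f.baseChange ℝ) (p := Polynomial.X ^ N - 1) (by simp [h2])
    have h3 := congrArg (Polynomial.eval r) hq
    rw [Polynomial.eval_mul, (Module.End.isRoot_of_hasEigenvalue hev).eq_zero, zero_mul] at h3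
    simpa [sub_eq_zero] using h3
  have hr1 : r = 1 ∨ r = -1 := by
    have h : |r| ^ N = 1 := by rw [← abs_pow, hrN, abs_one]
    have := (pow_eq_one_iff_of_nonneg (abs_nonneg r) hN).1 h
    exact (abs_eq zero_le_one).1 this
  have key : ∀ q : ℚ, r = algebraMap ℚ ℝ q → ∃ w ≠ 0, f w = q • w := by
    intro q hq
    rw [LinearMap.charpoly_baseChange, hq, Polynomial.isRoot_map_iff (algebraMap ℚ ℝ).injective]
      at hr
    obtain ⟨w, hw⟩ :=
      ((Module.End.hasEigenvalue_iff_isRoot_charpoly f q).2 hr).exists_hasEigenvector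
    exact ⟨w, hw.2, hw.apply_eq_smul⟩
  rcases hr1 with h | h
  · obtain ⟨w, hw, e⟩ := key 1 (by simpa using h)
    exact ⟨w, hw, Or.inl (by simpa using e)⟩
  · obtain ⟨w, hw, e⟩ := key (-1) (by simpa using h)
    exact ⟨w, hw, Or.inr (by simpa using e)⟩

/-- An endomorphism of finite order of an odd-dimensional rational vector space has an
odd-dimensional eigenspace for the eigenvalue `1` or `-1`. -/
theorem odd_finrank_ker_sub_one_or_add_one {W : Type*} [AddCommGroup W] [Module ℚ W]
    [FiniteDimensional ℚ W] {f : Module.End ℚ W} {N : ℕ} (hN : N ≠ 0) (hf : f ^ N = 1)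
    (hodd : Odd (Module.finrank ℚ W)) :
    Odd (Module.finrank ℚ (LinearMap.ker (f - 1))) ∨
      Odd (Module.finrank ℚ (LinearMap.ker (f + 1))) := by
  set g : Module.End ℚ W := f * f - 1 with hg
  -- If `f²` fixes `w = f² x - x`, then `f^(2k) x = x + k w`; at `k = N` this forces `N w = 0`.
  -- Hence the range of `f² - 1` contains no eigenvector for `±1`, and its dimension must be even.
  have hfix : ∀ w x : W, f (f w) = w → w = f (f x) - x → w = 0 := by
    intro w x hw hx
    have h : ∀ k : ℕ, ((f * f) ^ k) x = x + (k : ℚ) • w := by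
      intro k
      induction k with
      | zero => simp
      | succ k ih =>
        rw [pow_succ', Module.End.mul_apply, ih, map_add, map_smul, Module.End.mul_apply,
          Module.End.mul_apply, hw, Nat.cast_succ, add_smul, one_smul]
        rw [← sub_add_cancel (f (f x)) x, ← hx]
        abel
    have h2 := h N
    rw [(Commute.refl f).mul_pow, hf, mul_one, Module.End.one_apply, left_eq_add] at h2
    rcases smul_eq_zero.1 h2 with h | h
    · exact absurd (by exact_mod_cast h) hN
    · exact h
  have hinv : ∀ w ∈ LinearMap.range g, f w ∈ LinearMap.range g := by
    rintro _ ⟨x, rfl⟩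
    exact ⟨f x, by simp [hg]⟩
  have heven : ¬ Odd (Module.finrank ℚ (LinearMap.range g)) := by
    intro ho
    obtain ⟨w, hw0, hw⟩ := exists_apply_eq_or_neg_of_odd_finrank (f := f.restrict hinv) hN
      (by rw [Module.End.pow_restrict N]; ext x; simp [hf]) ho
    obtain ⟨⟨w, x, rfl⟩, hw'⟩ : ∃ w' : LinearMap.range g, w' = w := ⟨w, rfl⟩
    subst hw'
    apply hw0
    have : f (f (g x)) = g x := by
      rcases hw with hw | hw
      · have := congrArg Subtype.val hw
        simp only [LinearMap.restrict_apply] at this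
        rw [this, this]
      · have := congrArg Subtype.val hw
        simp only [LinearMap.restrict_apply, Submodule.coe_neg] at this
        rw [this, map_neg, this, neg_neg]
    ext
    exact hfix _ x this (by simp [hg])
  have hker : Odd (Module.finrank ℚ (LinearMap.ker g)) := by
    have := LinearMap.finrank_range_add_finrank_ker g
    rw [← this, Nat.odd_add] at hodd
    rw [Nat.not_odd_iff_even] at heven
    by_contra h
    rw [Nat.not_odd_iff_even] at h
    exact (Nat.not_odd_iff_even.2 heven) (hodd.2 h)
  have hsup : LinearMap.ker (f - 1) ⊔ LinearMap.ker (f + 1) = LinearMap.ker g := by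
    apply le_antisymm
    · refine sup_le ?_ ?_
      · intro x hx
        have h : f x = x := by simpa [sub_eq_zero] using hx
        simp [hg, h]
      · intro x hx
        have h : f x = -x := by simpa [eq_neg_iff_add_eq_zero] using hx
        simp [hg, h]
    · intro x hx
      have h : f (f x) = x := by simpa [hg, sub_eq_zero] using hx
      refine Submodule.mem_sup.2 ⟨(1 / 2 : ℚ) • (x + f x), ?_, (1 / 2 : ℚ) • (x - f x), ?_, ?_⟩
      · simp [h, add_comm]
      · simp [h]
      · rw [← smul_add, add_add_sub_cancel, ← two_smul ℚ x, smul_smul]; norm_num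
  have hinf : LinearMap.ker (f - 1) ⊓ LinearMap.ker (f + 1) = ⊥ := by
    rw [eq_bot_iff]
    rintro x ⟨h1, h2⟩
    have h : f x = x := by simpa [sub_eq_zero] using h1
    have h' : f x = -x := by simpa [eq_neg_iff_add_eq_zero] using h2
    rw [h] at h'
    have h2 : (2 : ℚ) • x = 0 := by rw [two_smul]; exact eq_neg_iff_add_eq_zero.1 h'
    exact (smul_eq_zero.1 h2).resolve_left two_ne_zero
  have hdim := Submodule.finrank_sup_add_finrank_inf_eq (LinearMap.ker (f - 1))
    (LinearMap.ker (f + 1))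
  rw [hsup, hinf, finrank_bot, add_zero] at hdim
  rw [hdim, Nat.odd_add] at hker
  by_cases h : Odd (Module.finrank ℚ (LinearMap.ker (f - 1)))
  · exact Or.inl h
  · exact Or.inr (by rw [← Nat.not_even_iff_odd]; exact fun h' => h (hker.2 h'))

end Module.End

/-! ### Joint sign eigenspaces of commuting maps -/

namespace LinearEquiv

open Module

variable {V : Type*} [AddCommGroup V] [Module ℚ V]

/-- The vectors of `U` on which every `d ∈ D` acts as the scalar `χ d`. -/
def weightSpace (D : Set (V ≃ₗ[ℚ] V)) (χ : (V ≃ₗ[ℚ] V) → ℚ) (U : Submodule ℚ V) :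
    Submodule ℚ V where
  carrier := {u | u ∈ U ∧ ∀ d ∈ D, d u = χ d • u}
  zero_mem' := ⟨U.zero_mem, by simp⟩
  add_mem' := fun ha hb => ⟨U.add_mem ha.1 hb.1, fun d hd => by
    rw [map_add, ha.2 d hd, hb.2 d hd, smul_add]⟩
  smul_mem' := fun c _ ha => ⟨U.smul_mem c ha.1, fun d hd => by
    rw [map_smul, ha.2 d hd, smul_comm]⟩

theorem mem_weightSpace {D : Set (V ≃ₗ[ℚ] V)} {χ : (V ≃ₗ[ℚ] V) → ℚ} {U : Submodule ℚ V} {u : V} :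
    u ∈ weightSpace D χ U ↔ u ∈ U ∧ ∀ d ∈ D, d u = χ d • u := Iff.rfl

theorem weightSpace_le (D : Set (V ≃ₗ[ℚ] V)) (χ : (V ≃ₗ[ℚ] V) → ℚ) (U : Submodule ℚ V) :
    weightSpace D χ U ≤ U := fun _ h => h.1

/-- Commuting automorphisms of finite order of an odd-dimensional rational vector space have an
odd-dimensional joint eigenspace with eigenvalues `±1`. -/
theorem exists_odd_finrank_weightSpace [FiniteDimensional ℚ V] {D : Set (V ≃ₗ[ℚ] V)}
    (hfin : ∀ d ∈ D, IsOfFinOrder d) {U : Submodule ℚ V} (hodd : Odd (finrank ℚ U))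
    (hinv : ∀ d ∈ D, ∀ u ∈ U, d u ∈ U) (hcomm : ∀ d ∈ D, ∀ e ∈ D, ∀ u ∈ U, d (e u) = e (d u)) :
    ∃ χ : (V ≃ₗ[ℚ] V) → ℚ, (∀ d, χ d = 1 ∨ χ d = -1) ∧ Odd (finrank ℚ (weightSpace D χ U)) := by
  induction hn : finrank ℚ U using Nat.strong_induction_on generalizing U with
  | _ n ih =>
  subst hn
  -- Either every `d ∈ D` is already a sign on `U`, or some `d` splits off a strictly smaller
  -- odd-dimensional eigenspace, which is `D`-invariant by commutation.
  by_cases hsc : ∀ d ∈ D, ∃ ε : ℚ, (ε = 1 ∨ ε = -1) ∧ ∀ u ∈ U, d u = ε • u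
  · classical
    choose! ε hε1 hε2 using hsc
    -- The value `1` outside `D` only serves to keep `χ` a sign everywhere.
    refine ⟨fun d => if d ∈ D then ε d else 1, fun d => ?_, ?_⟩
    · dsimp only
      split_ifs with h
      · exact hε1 d h
      · exact Or.inl rfl
    · have : weightSpace D (fun d => if d ∈ D then ε d else 1) U = U := by
        refine le_antisymm (weightSpace_le _ _ _) fun u hu => ⟨hu, fun d hd => ?_⟩
        dsimp only
        rw [if_pos hd]
        exact hε2 d hd u hu
      rw [this]
      exact hodd
  · push Not at hsc
    obtain ⟨d, hd, hne⟩ := hsc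
    obtain ⟨N, hN, hdN⟩ := isOfFinOrder_iff_pow_eq_one.1 (hfin d hd)
    set f : Module.End ℚ U := (d : V →ₗ[ℚ] V).restrict (hinv d hd) with hf
    have hfN : f ^ N = 1 := by
      have hpow : ∀ (k : ℕ) (u : U), ((f ^ k) u : V) = (d ^ k) u := by
        intro k
        induction k with
        | zero => intro u; rfl
        | succ k ihk => intro u; rw [pow_succ, pow_succ, Module.End.mul_apply, ihk]; rfl
      ext u
      rw [hpow, hdN]
      rfl
    obtain ⟨ε, hε, hεodd⟩ : ∃ ε : ℚ, (ε = 1 ∨ ε = -1) ∧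
        Odd (finrank ℚ (LinearMap.ker (f - ε • (1 : Module.End ℚ U)))) := by
      rcases Module.End.odd_finrank_ker_sub_one_or_add_one hN.ne' hfN hodd with h | h
      · exact ⟨1, Or.inl rfl, by rwa [one_smul]⟩
      · exact ⟨-1, Or.inr rfl, by
          rwa [show f - (-1 : ℚ) • (1 : Module.End ℚ U) = f + 1 by
            ext; simp]⟩
    set E := (LinearMap.ker (f - ε • (1 : Module.End ℚ U))).map U.subtype with hE
    have hmemE : ∀ u, u ∈ E ↔ u ∈ U ∧ d u = ε • u := by
      intro u
      simp only [hE, Submodule.mem_map, LinearMap.mem_ker, Subtype.exists, Submodule.subtype_apply,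
        exists_and_right, exists_eq_right]
      refine ⟨fun ⟨hu, h⟩ => ⟨hu, ?_⟩, fun ⟨hu, h⟩ => ⟨hu, ?_⟩⟩
      · have := congrArg Subtype.val h
        simpa [hf, LinearMap.restrict_apply, sub_eq_zero] using this
      · ext
        simpa [hf, LinearMap.restrict_apply, sub_eq_zero] using h
    have hEle : E ≤ U := fun u hu => ((hmemE u).1 hu).1
    have hEodd : Odd (finrank ℚ E) := by
      rw [hE, Submodule.finrank_map_subtype_eq]
      exact hεodd
    have hlt : finrank ℚ E < finrank ℚ U := by
      apply Submodule.finrank_lt_finrank_of_lt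
      refine lt_of_le_of_ne hEle fun h => ?_
      obtain ⟨u, hu, hu'⟩ := hne ε hε
      rw [← h] at hu
      exact hu' ((hmemE u).1 hu).2
    obtain ⟨χ, hχ, hχodd⟩ := ih _ hlt hEodd
      (fun e he u hu => (hmemE _).2 ⟨hinv e he u (hEle hu), by
        rw [hcomm d hd e he u (hEle hu), ((hmemE u).1 hu).2, map_smul]⟩)
      (fun a ha b hb u hu => hcomm a ha b hb u (hEle hu)) rfl
    refine ⟨χ, hχ, ?_⟩
    have hχd : χ d = ε := by
      have hpos : weightSpace D χ E ≠ ⊥ := by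
        intro h
        rw [h, finrank_bot] at hχodd
        simp at hχodd
      obtain ⟨u, hu, hu0⟩ := Submodule.exists_mem_ne_zero_of_ne_bot hpos
      have h1 := hu.2 d hd
      rw [((hmemE u).1 hu.1).2] at h1
      exact (smul_left_injective ℚ hu0 h1).symm
    have : weightSpace D χ U = weightSpace D χ E := by
      ext u
      simp only [mem_weightSpace]
      refine ⟨fun h => ⟨(hmemE u).2 ⟨h.1, hχd ▸ h.2 d hd⟩, h.2⟩, fun h => ⟨hEle h.1, h.2⟩⟩
    rw [this]
    exact hχodd

end LinearEquiv

/-! ### Derived subgroups inside an ambient group -/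

namespace Subgroup

variable {X : Type*} [Group X]

/-- The iterated commutator subgroups of a subgroup. -/
def iteratedCommutator (K : Subgroup X) : ℕ → Subgroup X
  | 0 => K
  | i + 1 => ⁅iteratedCommutator K i, iteratedCommutator K i⁆

theorem iteratedCommutator_eq_map_derivedSeries (K : Subgroup X) (i : ℕ) :
    K.iteratedCommutator i = (derivedSeries K i).map K.subtype := by
  induction i with
  | zero => rw [derivedSeries_zero, ← MonoidHom.range_eq_map, range_subtype]; rfl
  | succ i ih => rw [derivedSeries_succ, map_commutator, ← ih]; rfl

theorem iteratedCommutator_le (K : Subgroup X) (i : ℕ) : K.iteratedCommutator i ≤ K := by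
  rw [iteratedCommutator_eq_map_derivedSeries]
  exact map_subtype_le _

theorem map_iteratedCommutator {Y : Type*} [Group Y] (f : X →* Y) (K : Subgroup X) (i : ℕ) :
    (K.iteratedCommutator i).map f = (K.map f).iteratedCommutator i := by
  induction i with
  | zero => rfl
  | succ i ih => exact (map_commutator _ _ f).trans (by rw [ih]; rfl)

theorem iteratedCommutator_succ_le_commutator (K : Subgroup X) (i : ℕ) :
    K.iteratedCommutator (i + 1) ≤ ⁅K, K⁆ :=
  commutator_mono (K.iteratedCommutator_le i) (K.iteratedCommutator_le i)

theorem exists_iteratedCommutator_eq_bot (K : Subgroup X) [Group.IsSolvable K] :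
    ∃ i, K.iteratedCommutator i = ⊥ := by
  obtain ⟨i, hi⟩ := Group.IsSolvable.solvable (G := K)
  exact ⟨i, by rw [iteratedCommutator_eq_map_derivedSeries, hi, map_bot]⟩

theorem normalizes_iteratedCommutator {K : Subgroup X} {x : X} (h : K.map (MulAut.conj x) = K)
    (i : ℕ) : (K.iteratedCommutator i).map (MulAut.conj x) = K.iteratedCommutator i := by
  rw [map_iteratedCommutator, h]

theorem map_conj_eq_of_finite {K : Subgroup X} [Finite K] {x : X}
    (h : ∀ k ∈ K, x * k * x⁻¹ ∈ K) : K.map (MulAut.conj x) = K := by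
  apply SetLike.coe_injective
  have hle : ((K.map (MulAut.conj x) : Subgroup X) : Set X) ⊆ K := by
    rintro _ ⟨k, hk, rfl⟩
    exact h k hk
  refine Set.eq_of_subset_of_ncard_le hle ?_ (Set.toFinite _)
  rw [coe_map]
  exact (Set.ncard_image_of_injective _ (MulAut.conj x).injective).ge

theorem map_conj_eq_of_mem {K : Subgroup X} {x : X} (h : x ∈ K) : K.map (MulAut.conj x) = K := by
  ext y
  simp only [mem_map, MonoidHom.coe_coe, MulAut.conj_apply]
  refine ⟨?_, fun hy => ⟨x⁻¹ * y * x, K.mul_mem (K.mul_mem (K.inv_mem h) hy) h, by group⟩⟩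
  rintro ⟨k, hk, rfl⟩
  exact K.mul_mem (K.mul_mem h hk) (K.inv_mem h)

end Subgroup

/-! ### Clifford theory and the fixed vector -/

namespace LinearEquiv

open Module
open scoped commutatorElement

variable {V : Type*} [AddCommGroup V] [Module ℚ V]

/-- The sum of all the weight spaces of `D` for weights `±1` different from `χ`. -/
def offWeight (D : Set (V ≃ₗ[ℚ] V)) (χ : (V ≃ₗ[ℚ] V) → ℚ) : Submodule ℚ V :=
  Submodule.span ℚ {w | ∃ ψ : (V ≃ₗ[ℚ] V) → ℚ, (∀ d, ψ d = 1 ∨ ψ d = -1) ∧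
    (∃ d ∈ D, ψ d ≠ χ d) ∧ ∀ d ∈ D, d w = ψ d • w}

/-- The product of the maps `(1 + χ(d) d) / 2` over `d ∈ D` is the identity on weight `χ` and kills
every sign weight differing from `χ` on `D`. No commutativity of `D` is needed, because the product
is evaluated only on joint eigenvectors and their span. -/
theorem eq_zero_of_mem_weightSpace_of_mem_offWeight {D : Set (V ≃ₗ[ℚ] V)} (hD : D.Finite)
    {χ : (V ≃ₗ[ℚ] V) → ℚ} (hχ : ∀ d, χ d = 1 ∨ χ d = -1) {U : Submodule ℚ V} {u : V}
    (hu : u ∈ weightSpace D χ U) (hu' : u ∈ offWeight D χ) : u = 0 := by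
  let F : (V ≃ₗ[ℚ] V) → Module.End ℚ V := fun d =>
    (1 / 2 : ℚ) • (1 + χ d • (d : V →ₗ[ℚ] V))
  have hF : ∀ (l : List (V ≃ₗ[ℚ] V)) (ψ : (V ≃ₗ[ℚ] V) → ℚ) (w : V), (∀ d ∈ l, d w = ψ d • w) →
      (l.map F).prod w = (l.map fun d => (1 / 2 : ℚ) * (1 + χ d * ψ d)).prod • w := by
    intro l ψ w
    induction l with
    | nil => simp
    | cons d l ih =>
      intro h
      rw [List.map_cons, List.prod_cons, Module.End.mul_apply,
        ih fun e he => h e (List.mem_cons_of_mem _ he), LinearMap.map_smul, List.map_cons, List.prod_cons,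
        mul_comm, mul_smul]
      congr 1
      have hd : (d : V →ₗ[ℚ] V) w = ψ d • w := h d List.mem_cons_self
      simp only [F, LinearMap.smul_apply, LinearMap.add_apply, Module.End.one_apply, hd]
      module
  let l := hD.toFinset.toList
  have hl : ∀ d, d ∈ l ↔ d ∈ D := by simp [l]
  have hfix : (l.map F).prod u = u := by
    rw [hF l χ u fun d hd => hu.2 d ((hl d).1 hd)]
    have : (l.map fun d => (1 / 2 : ℚ) * (1 + χ d * χ d)) = l.map fun _ => (1 : ℚ) := by
      refine List.map_congr_left fun d _ => ?_
      rcases hχ d with h | h <;> rw [h] <;> norm_num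
    rw [this]
    simp
  have hkill : offWeight D χ ≤ LinearMap.ker (l.map F).prod := by
    refine Submodule.span_le.2 ?_
    rintro w ⟨ψ, hψ, ⟨d, hd, hne⟩, hw⟩
    rw [SetLike.mem_coe, LinearMap.mem_ker, hF l ψ w fun d hd => hw d ((hl d).1 hd)]
    have : (l.map fun d => (1 / 2 : ℚ) * (1 + χ d * ψ d)).prod = 0 := by
      refine List.prod_eq_zero (List.mem_map.2 ⟨d, (hl d).2 hd, ?_⟩)
      rcases hχ d with h | h <;> rcases hψ d with h' | h' <;> rw [h, h'] at hne ⊢ <;>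
        first | exact absurd rfl hne | norm_num
    rw [this, zero_smul]
  rw [← hfix]
  exact hkill hu'

/-- The elements of the normalizer of `D` that fix the weight `χ`. -/
def weightStabilizer (D : Subgroup (V ≃ₗ[ℚ] V)) (χ : (V ≃ₗ[ℚ] V) → ℚ) :
    Subgroup (V ≃ₗ[ℚ] V) where
  carrier := {x | (∀ d, x⁻¹ * d * x ∈ D ↔ d ∈ D) ∧ ∀ d ∈ D, χ (x⁻¹ * d * x) = χ d}
  one_mem' := by simp
  mul_mem' := by
    rintro x y ⟨hx, hx'⟩ ⟨hy, hy'⟩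
    have h : ∀ d, (x * y)⁻¹ * d * (x * y) = y⁻¹ * (x⁻¹ * d * x) * y := fun d => by group
    refine ⟨fun d => by rw [h, hy, hx], fun d hd => ?_⟩
    rw [h, hy' _ ((hx d).2 hd), hx' d hd]
  inv_mem' := by
    rintro x ⟨hx, hx'⟩
    have h : ∀ d, x⁻¹ * (x⁻¹⁻¹ * d * x⁻¹) * x = d := fun d => by group
    have h1 : ∀ d, x⁻¹⁻¹ * d * x⁻¹ ∈ D ↔ d ∈ D := fun d => by rw [← hx, h]
    refine ⟨h1, fun d hd => ?_⟩
    rw [← hx' _ ((h1 d).2 hd), h]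

theorem normalizes_iff {D : Subgroup (V ≃ₗ[ℚ] V)} {x : V ≃ₗ[ℚ] V}
    (h : D.map (MulAut.conj x) = D) (d : V ≃ₗ[ℚ] V) : x⁻¹ * d * x ∈ D ↔ d ∈ D := by
  constructor
  · intro hd
    rw [← h]
    exact ⟨_, hd, by simp [mul_assoc]⟩
  · intro hd
    rw [← h] at hd
    obtain ⟨e, he, rfl⟩ := hd
    simpa [mul_assoc] using he

theorem apply_eq_apply_conj (x d : V ≃ₗ[ℚ] V) (u : V) : d (x u) = x ((x⁻¹ * d * x) u) := by
  rw [← LinearEquiv.mul_apply, ← LinearEquiv.mul_apply]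
  congr 1
  group

/-- A normalizing `x` carries weight `χ` to the weight `d ↦ χ (x⁻¹ * d * x)`, which differs from `χ`
on `D` exactly when `x` does not stabilize `χ`. -/
theorem apply_mem_offWeight {D : Subgroup (V ≃ₗ[ℚ] V)} {χ : (V ≃ₗ[ℚ] V) → ℚ}
    (hχ : ∀ d, χ d = 1 ∨ χ d = -1) {U : Submodule ℚ V} {x : V ≃ₗ[ℚ] V}
    (hx : D.map (MulAut.conj x) = D) (hx' : x ∉ weightStabilizer D χ) {u : V}
    (hu : u ∈ weightSpace D χ U) : x u ∈ offWeight (D : Set (V ≃ₗ[ℚ] V)) χ := by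
  refine Submodule.subset_span ⟨fun d => χ (x⁻¹ * d * x), fun d => hχ _, ?_, fun d hd => ?_⟩
  · by_contra hne
    push Not at hne
    exact hx' ⟨normalizes_iff hx, hne⟩
  · rw [apply_eq_apply_conj, hu.2 _ ((normalizes_iff hx d).2 hd), map_smul]

theorem apply_mem_weightSpace {D : Subgroup (V ≃ₗ[ℚ] V)} {χ : (V ≃ₗ[ℚ] V) → ℚ}
    {U : Submodule ℚ V} {x : V ≃ₗ[ℚ] V} (hx : x ∈ weightStabilizer D χ)
    (hxU : ∀ u ∈ U, x u ∈ U) {u : V} (hu : u ∈ weightSpace D χ U) :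
    x u ∈ weightSpace D χ U := by
  refine ⟨hxU u hu.1, fun d hd => ?_⟩
  rw [apply_eq_apply_conj, hu.2 _ ((hx.1 d).2 hd), map_smul, hx.2 d hd]

/-- A subspace is irreducible under a set of automorphisms. -/
def IsIrreducibleOn (K : Subgroup (V ≃ₗ[ℚ] V)) (U : Submodule ℚ V) : Prop :=
  (∀ k ∈ K, ∀ u ∈ U, k u ∈ U) ∧
    ∀ W ≤ U, (∀ k ∈ K, ∀ w ∈ W, k w ∈ W) → W = ⊥ ∨ W = U

/-- If `u ≠ 0` and all its translates under `K` lie in `S`, then so does the irreducible `U`. -/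
theorem IsIrreducibleOn.le_of_translates {K : Subgroup (V ≃ₗ[ℚ] V)} {U : Submodule ℚ V}
    (h : IsIrreducibleOn K U) {S : Submodule ℚ V} {u : V} (hu : u ∈ U) (hu0 : u ≠ 0)
    (hS : ∀ k ∈ K, k u ∈ S) : U ≤ S := by
  let T : Submodule ℚ V := Submodule.span ℚ {w | ∃ k ∈ K, w = k u}
  have hTU : T ≤ U := Submodule.span_le.2 (by rintro _ ⟨k, hk, rfl⟩; exact h.1 k hk u hu)
  have hTS : T ≤ S := Submodule.span_le.2 (by rintro _ ⟨k, hk, rfl⟩; exact hS k hk)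
  have hT : ∀ k ∈ K, ∀ w ∈ T, k w ∈ T := by
    intro k hk
    suffices T ≤ T.comap (k : V →ₗ[ℚ] V) from this
    refine Submodule.span_le.2 ?_
    rintro _ ⟨l, hl, rfl⟩
    exact Submodule.subset_span ⟨k * l, K.mul_mem hk hl, rfl⟩
  rcases h.2 T hTU hT with h0 | h1
  · have : u ∈ T := Submodule.subset_span ⟨1, K.one_mem, rfl⟩
    rw [h0] at this
    exact absurd this hu0
  · rw [← h1]; exact hTS

/-- The stabilizer of a weight acts irreducibly on the weight space of an irreducible space. -/
theorem IsIrreducibleOn.weightSpace {K D : Subgroup (V ≃ₗ[ℚ] V)} [Finite K] {U : Submodule ℚ V}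
    (h : IsIrreducibleOn K U) (hDK : D ≤ K) (hD : ∀ k ∈ K, D.map (MulAut.conj k) = D)
    {χ : (V ≃ₗ[ℚ] V) → ℚ} (hχ : ∀ d, χ d = 1 ∨ χ d = -1) :
    IsIrreducibleOn (K ⊓ weightStabilizer D χ)
      (LinearEquiv.weightSpace (D : Set (V ≃ₗ[ℚ] V)) χ U) := by
  have hfin : (D : Set (V ≃ₗ[ℚ] V)).Finite := (Set.toFinite (K : Set (V ≃ₗ[ℚ] V))).subset hDK
  refine ⟨fun k hk u hu => apply_mem_weightSpace hk.2 (h.1 k hk.1) hu, fun S hS hinv => ?_⟩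
  rw [or_iff_not_imp_left]
  intro hne
  obtain ⟨s, hs, hs0⟩ := Submodule.exists_mem_ne_zero_of_ne_bot hne
  -- Translates of `s` by the stabilizer remain in `S` and all others are off-weight, so
  -- irreducibility of `U` gives the inclusion. Comparing components of weight `χ` then shows that
  -- `S` is the whole weight space.
  have hle : U ≤ S ⊔ offWeight (D : Set (V ≃ₗ[ℚ] V)) χ := by
    refine h.le_of_translates (hS hs).1 hs0 fun k hk => ?_
    by_cases hk' : k ∈ weightStabilizer D χ
    · exact Submodule.mem_sup_left (hinv k ⟨hk, hk'⟩ s hs)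
    · exact Submodule.mem_sup_right (apply_mem_offWeight hχ (hD k hk) hk' (hS hs))
  refine le_antisymm hS fun u hu => ?_
  obtain ⟨t, ht, o, ho, rfl⟩ := Submodule.mem_sup.1 (hle hu.1)
  have : o = 0 := eq_zero_of_mem_weightSpace_of_mem_offWeight hfin hχ
    (by simpa using Submodule.sub_mem _ hu (hS ht)) ho
  rw [this, add_zero]
  exact ht

/-- On an odd-dimensional invariant space no product of commutators acts as `-1`. -/
theorem not_forall_apply_eq_neg_of_mem_commutator [FiniteDimensional ℚ V]
    {K : Subgroup (V ≃ₗ[ℚ] V)} {U : Submodule ℚ V} (hK : ∀ k ∈ K, ∀ u ∈ U, k u ∈ U)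
    (hodd : Odd (finrank ℚ U)) {d : V ≃ₗ[ℚ] V} (hd : d ∈ ⁅K, K⁆) : ¬ ∀ u ∈ U, d u = -u := by
  intro hneg
  let r : K →* Module.End ℚ U :=
    { toFun := fun k => ((k : V ≃ₗ[ℚ] V) : V →ₗ[ℚ] V).restrict (hK k k.2)
      map_one' := rfl
      map_mul' := fun _ _ => rfl }
  -- The determinant is trivial on commutators, whereas `-1` has determinant `-1` in odd dimension.
  let δ : K →* ℚ := LinearMap.det.comp r
  have hle : ⁅K, K⁆ ≤ δ.ker.map K.subtype := by
    rw [Subgroup.commutator_le]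
    intro a ha b hb
    refine ⟨⁅(⟨a, ha⟩ : K), (⟨b, hb⟩ : K)⁆, ?_, rfl⟩
    have hu : ∀ k : K, δ k * δ k⁻¹ = 1 := fun k => by rw [← map_mul, mul_inv_cancel, map_one]
    rw [SetLike.mem_coe, MonoidHom.mem_ker, commutatorElement_def, map_mul, map_mul, map_mul]
    linear_combination hu ⟨a, ha⟩ * (δ ⟨b, hb⟩ * δ ⟨b, hb⟩⁻¹) + hu ⟨b, hb⟩
  obtain ⟨k, hk, rfl⟩ := hle hd
  have hr : r k = -1 := by
    ext u
    exact hneg u u.2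
  have h1 : δ k = (-1) ^ finrank ℚ U := by
    have : δ k = LinearMap.det (r k) := rfl
    rw [this, hr, ← neg_one_smul ℚ (1 : Module.End ℚ U), LinearMap.det_smul, map_one, mul_one]
  rw [MonoidHom.mem_ker.1 hk, hodd.neg_one_pow] at h1
  norm_num at h1

/-- A rational eigenvalue of an automorphism preserving a lattice is `1` or `-1`. -/
theorem eigenvalue_eq_one_or_neg_one {L : Submodule ℤ V} (hfg : L.FG) {A : V ≃ₗ[ℚ] V}
    (hA : ∀ v ∈ L, A v ∈ L) (hA' : ∀ v ∈ L, A⁻¹ v ∈ L) {v : V} (hv : v ∈ L) (hv0 : v ≠ 0)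
    {q : ℚ} (hq : A v = q • v) : q = 1 ∨ q = -1 := by
  have hq0 : q ≠ 0 := by
    rintro rfl
    rw [zero_smul] at hq
    exact hv0 (A.map_eq_zero_iff.1 hq)
  -- The part of the lattice on the eigenline is a non-zero finitely generated group stable under
  -- `q` and `q⁻¹`; both are therefore integral, and `q` is a unit of `ℤ`.
  let N : Submodule ℤ V := L ⊓ (ℚ ∙ v).restrictScalars ℤ
  have hNfg : N.FG := by
    have : IsNoetherian ℤ L := isNoetherian_of_fg_of_noetherian L hfg
    exact Submodule.FG.of_le hfg inf_le_left
  have hN : N ≠ ⊥ := fun h => hv0 (by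
    have : v ∈ N := ⟨hv, Submodule.mem_span_singleton_self v⟩
    rwa [h] at this)
  have hline : ∀ w ∈ (ℚ ∙ v), A w = q • w := by
    intro w hw
    obtain ⟨c, rfl⟩ := Submodule.mem_span_singleton.1 hw
    rw [map_smul, hq, smul_comm]
  have hline' : ∀ w ∈ (ℚ ∙ v), A⁻¹ w = q⁻¹ • w := by
    intro w hw
    have h := hline w hw
    have : A⁻¹ (A w) = w := by rw [← LinearEquiv.mul_apply, inv_mul_cancel]; rfl
    rw [h, map_smul] at this
    rw [← this, smul_smul, inv_mul_cancel₀ hq0, one_smul, this]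
  have h1 : IsIntegral ℤ q := isIntegral_of_smul_mem_submodule N hN hNfg q fun w hw =>
    ⟨hline w hw.2 ▸ hA w hw.1, Submodule.smul_mem _ q hw.2⟩
  have h2 : IsIntegral ℤ q⁻¹ := isIntegral_of_smul_mem_submodule N hN hNfg q⁻¹ fun w hw =>
    ⟨hline' w hw.2 ▸ hA' w hw.1, Submodule.smul_mem _ q⁻¹ hw.2⟩
  obtain ⟨a, ha⟩ := IsIntegrallyClosed.isIntegral_iff.1 h1
  obtain ⟨b, hb⟩ := IsIntegrallyClosed.isIntegral_iff.1 h2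
  have hab : a * b = 1 := by
    have : (algebraMap ℤ ℚ a) * algebraMap ℤ ℚ b = 1 := by rw [ha, hb, mul_inv_cancel₀ hq0]
    rw [← map_mul] at this
    exact (algebraMap ℤ ℚ).injective_int (this.trans (map_one _).symm)
  rcases Int.eq_one_or_neg_one_of_mul_eq_one hab with h | h
  · left; rw [← ha, h]; simp
  · right; rw [← ha, h]; simp

/-- Let `K` be a finite solvable group of automorphisms of a rational vector space, acting
irreducibly and non-trivially on an odd-dimensional subspace `U`, and let `A` normalize `K`,
preserve `U`, and preserve a lattice together with `K`. Then some element of the coset `K * A` has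
a non-zero fixed vector in `U`. -/
theorem exists_mul_apply_eq_self [FiniteDimensional ℚ V] {L : Submodule ℤ V} (hfg : L.FG)
    (hL : ∀ v : V, ∃ m : ℤ, m ≠ 0 ∧ m • v ∈ L) {K : Subgroup (V ≃ₗ[ℚ] V)} [Finite K]
    [Group.IsSolvable K] {U : Submodule ℚ V} (hirr : IsIrreducibleOn K U)
    (hodd : Odd (finrank ℚ U)) (hnontriv : ∃ k ∈ K, ∃ u ∈ U, k u ≠ u)
    (hKL : ∀ k ∈ K, ∀ v ∈ L, k v ∈ L) {A : V ≃ₗ[ℚ] V} (hAU : ∀ u ∈ U, A u ∈ U)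
    (hAK : ∀ k ∈ K, A * k * A⁻¹ ∈ K) (hAL : ∀ v ∈ L, A v ∈ L) (hAL' : ∀ v ∈ L, A⁻¹ v ∈ L) :
    ∃ k ∈ K, ∃ u ∈ U, u ≠ 0 ∧ k (A u) = u := by
  induction hn : finrank ℚ U using Nat.strong_induction_on generalizing U K A with
  | _ n ih =>
  subst hn
  classical
  -- `D` is the last iterated commutator subgroup of `K` that acts non-trivially on `U`.
  have hex : ∃ i, ∀ d ∈ K.iteratedCommutator i, ∀ u ∈ U, d u = u := by
    obtain ⟨i, hi⟩ := K.exists_iteratedCommutator_eq_bot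
    refine ⟨i, fun d hd u _ => ?_⟩
    rw [hi, Subgroup.mem_bot] at hd
    rw [hd]
    rfl
  obtain ⟨i, hi⟩ : ∃ i, Nat.find hex = i + 1 := by
    refine Nat.exists_eq_succ_of_ne_zero fun h0 => ?_
    obtain ⟨k, hk, u, hu, hne⟩ := hnontriv
    have := Nat.find_spec hex
    rw [h0] at this
    exact hne (this k hk u hu)
  set D := K.iteratedCommutator i with hDdef
  have hDK : D ≤ K := K.iteratedCommutator_le i
  have hDtriv : ∀ d ∈ ⁅D, D⁆, ∀ u ∈ U, d u = u := by
    have := Nat.find_spec hex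
    rw [hi] at this
    exact this
  have hDnontriv : ¬ ∀ d ∈ D, ∀ u ∈ U, d u = u :=
    Nat.find_min hex (by rw [hi]; exact Nat.lt_succ_self i)
  have hDnorm : ∀ k ∈ K, D.map (MulAut.conj k) = D := fun k hk =>
    Subgroup.normalizes_iteratedCommutator (Subgroup.map_conj_eq_of_mem hk) i
  have hDA : D.map (MulAut.conj A) = D :=
    Subgroup.normalizes_iteratedCommutator (Subgroup.map_conj_eq_of_finite hAK) i
  have hDfin : (D : Set (V ≃ₗ[ℚ] V)).Finite := (Set.toFinite (K : Set (V ≃ₗ[ℚ] V))).subset hDK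
  have hcomm : ∀ d ∈ D, ∀ e ∈ D, ∀ u ∈ U, d (e u) = e (d u) := by
    intro d hd e he u hu
    have h1 := hDtriv ⁅e⁻¹, d⁻¹⁆ (Subgroup.commutator_mem_commutator (D.inv_mem he)
      (D.inv_mem hd)) u hu
    rw [commutatorElement_def, inv_inv, inv_inv] at h1
    have h2 : (d * e) ((e⁻¹ * d⁻¹ * e * d) u) = (e * d) u := by
      rw [← LinearEquiv.mul_apply]
      congr 1
      group
    rw [h1] at h2
    exact h2
  obtain ⟨χ, hχ, hχodd⟩ := exists_odd_finrank_weightSpace (D := (D : Set (V ≃ₗ[ℚ] V)))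
    (fun d hd => by
      obtain ⟨m, hm, h⟩ := isOfFinOrder_iff_pow_eq_one.1 (isOfFinOrder_of_finite (⟨d, hDK hd⟩ : K))
      exact isOfFinOrder_iff_pow_eq_one.2 ⟨m, hm, congrArg Subtype.val h⟩)
    hodd (fun d hd => hirr.1 d (hDK hd)) hcomm
  set U' := weightSpace (D : Set (V ≃ₗ[ℚ] V)) χ U with hU'
  have hU'ne : U' ≠ ⊥ := fun h => by
    rw [h, finrank_bot] at hχodd
    simp at hχodd
  obtain ⟨v, hv, hv0⟩ := Submodule.exists_mem_ne_zero_of_ne_bot hU'ne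
  -- `D` acts without fixed vectors on `U`.
  have hDfix : ∃ d ∈ D, d v ≠ v := by
    by_contra hfix
    push Not at hfix
    apply hDnontriv
    intro d hd u hu
    have hle : U ≤ LinearMap.ker ((d : V →ₗ[ℚ] V) - 1) := by
      refine hirr.le_of_translates hv.1 hv0 fun k hk => ?_
      rw [LinearMap.mem_ker, LinearMap.sub_apply, sub_eq_zero]
      change d (k v) = k v
      rw [apply_eq_apply_conj, hfix _ ((normalizes_iff (hDnorm k hk) d).2 hd)]
    have := hle hu
    rw [LinearMap.mem_ker, LinearMap.sub_apply, sub_eq_zero] at this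
    exact this
  obtain ⟨d, hd, hdv⟩ := hDfix
  have hχd : χ d = -1 := (hχ d).resolve_left fun h => hdv (by rw [hv.2 d hd, h, one_smul])
  -- In the case of equality `D` acts on `U` by signs and `d` acts as `-1`. Either `D = K` and `U`
  -- is a line, or `d` is a product of commutators and the determinant gives a contradiction.
  by_cases hUU : U' = U
  · have hdneg : ∀ u ∈ U, d u = -u := fun u hu => by
      rw [← hUU] at hu
      rw [hu.2 d hd, hχd, neg_one_smul]
    rcases Nat.eq_zero_or_pos i with h0 | hpos
    · have hDK' : D = K := by rw [hDdef, h0]; rfl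
      have hline : U ≤ ℚ ∙ v := by
        refine hirr.le_of_translates hv.1 hv0 fun k hk => ?_
        rw [hv.2 k (by rw [hDK']; exact hk)]
        exact Submodule.smul_mem _ _ (Submodule.mem_span_singleton_self v)
      obtain ⟨q, hq⟩ := Submodule.mem_span_singleton.1 (hline (hAU v hv.1))
      obtain ⟨m, hm, hmv⟩ := hL v
      have hmv0 : m • v ≠ 0 := by
        rw [← Int.cast_smul_eq_zsmul ℚ]
        exact smul_ne_zero (Int.cast_ne_zero.2 hm) hv0
      have hAmv : A (m • v) = q • m • v := by rw [map_zsmul, ← hq, smul_comm]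
      rcases eigenvalue_eq_one_or_neg_one hfg hAL hAL' hmv hmv0 hAmv with h | h
      · exact ⟨1, K.one_mem, v, hv.1, hv0, by rw [← hq, h, one_smul]; rfl⟩
      · refine ⟨d, hDK hd, v, hv.1, hv0, ?_⟩
        rw [hdneg _ (hAU v hv.1), ← hq, h, neg_one_smul, neg_neg]
    · obtain ⟨j, rfl⟩ := Nat.exists_eq_succ_of_ne_zero hpos.ne'
      exact absurd hdneg (not_forall_apply_eq_neg_of_mem_commutator hirr.1 hodd
        (K.iteratedCommutator_succ_le_commutator j hd))
  · have hlt : finrank ℚ U' < finrank ℚ U :=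
      Submodule.finrank_lt_finrank_of_lt (lt_of_le_of_ne (weightSpace_le _ _ _) hUU)
    -- Some element of `K * A` fixes the weight `χ`.
    obtain ⟨k, hk, hkA⟩ : ∃ k ∈ K, k * A ∈ weightStabilizer D χ := by
      by_contra hno
      push Not at hno
      -- Otherwise every `K`-translate of `A v` is off-weight. These translates span `U`, which
      -- contains the non-zero vector `v` of weight `χ`.
      have hle : U ≤ offWeight (D : Set (V ≃ₗ[ℚ] V)) χ := by
        refine hirr.le_of_translates (hAU v hv.1) (fun h => hv0 (A.map_eq_zero_iff.1 h))
          fun k hk => ?_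
        refine apply_mem_offWeight (x := k * A) hχ ?_ (hno k hk) hv
        have : D.map (MulAut.conj (k * A)).toMonoidHom =
            (D.map (MulAut.conj A).toMonoidHom).map (MulAut.conj k).toMonoidHom := by
          rw [Subgroup.map_map, map_mul]
          rfl
        exact this.trans ((congrArg _ hDA).trans (hDnorm k hk))
      exact hv0 (eq_zero_of_mem_weightSpace_of_mem_offWeight hDfin hχ hv (hle hv.1))
    have : Finite ↥(K ⊓ weightStabilizer D χ) :=
      Finite.of_injective _ (Subgroup.inclusion_injective inf_le_left)
    have : Group.IsSolvable ↥(K ⊓ weightStabilizer D χ) :=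
      Group.isSolvable_of_isSolvable_injective
        (Subgroup.inclusion_injective (inf_le_left : K ⊓ weightStabilizer D χ ≤ K))
    -- Non-triviality survives the induction because `d` itself stabilizes `χ` and moves `v`.
    have hDstab : d ∈ weightStabilizer D χ := by
      refine ⟨normalizes_iff (hDnorm d (hDK hd)), fun e he => ?_⟩
      have h1 := hv.2 _ ((normalizes_iff (hDnorm d (hDK hd)) e).2 he)
      have h2 : (d⁻¹ * e * d) v = χ e • v := by
        apply d.injective
        rw [← apply_eq_apply_conj, hv.2 d hd, map_smul, map_smul, hv.2 e he, hv.2 d hd, smul_comm]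
      rw [h2] at h1
      exact (smul_left_injective ℚ hv0 h1).symm
    obtain ⟨l, hl, u, hu, hu0, hlu⟩ := ih _ hlt (K := K ⊓ weightStabilizer D χ) (A := k * A)
      (hirr.weightSpace hDK hDnorm hχ) hχodd ⟨d, ⟨hDK hd, hDstab⟩, v, hv, hdv⟩
      (fun l hl => hKL l hl.1)
      (fun u hu => apply_mem_weightSpace hkA (fun w hw => hirr.1 k hk _ (hAU w hw)) hu)
      (fun l hl => ⟨by
        have := K.mul_mem (K.mul_mem hk (hAK l hl.1)) (K.inv_mem hk)
        simpa [mul_assoc] using this,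
        Subgroup.mul_mem _ (Subgroup.mul_mem _ hkA hl.2) (Subgroup.inv_mem _ hkA)⟩)
      (fun w hw => hKL k hk _ (hAL w hw))
      (fun w hw => by
        rw [mul_inv_rev]
        exact hAL' _ (hKL _ (K.inv_mem hk) w hw)) rfl
    exact ⟨l * k, K.mul_mem hl.1 hk, u, hu.1, hu0, hlu⟩

end LinearEquiv

theorem Set.finite_range_of_factorsThrough {α β γ : Type*} {f : α → β} {g : α → γ}
    (hf : (Set.range f).Finite) (h : Function.FactorsThrough g f) : (Set.range g).Finite := by
  rcases isEmpty_or_nonempty α with hα | ⟨⟨a⟩⟩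
  · exact Set.toFinite _
  · refine (hf.image (Function.extend f g fun _ => g a)).subset ?_
    rintro _ ⟨b, rfl⟩
    exact ⟨f b, ⟨b, rfl⟩, h.extend_apply _ b⟩

/-! ### Reidemeister classes and invariant homomorphisms -/

section Reidemeister

/-- `F` is only a map of sets, so that right translation by an element is allowed as well as an
isomorphism. -/
theorem infinite_reidemeister_of_surjective {π Γ : Type*} [Group π] [Group Γ] {φ : π →* π}
    {ψ : Γ →* Γ} (hψ : Infinite (Quotient (reidemeisterSetoid ψ))) {F : π → Γ}
    (hF : Function.Surjective F)
    (h : ∀ α β, reidemeisterSetoid φ α β → reidemeisterSetoid ψ (F α) (F β)) :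
    Infinite (Quotient (reidemeisterSetoid φ)) := by
  refine Infinite.of_surjective
    (Quotient.map F h : Quotient (reidemeisterSetoid φ) → Quotient (reidemeisterSetoid ψ)) ?_
  rintro ⟨b⟩
  obtain ⟨a, rfl⟩ := hF b
  exact ⟨Quotient.mk _ a, rfl⟩

/-- Composing with an inner automorphism does not make infinitely many Reidemeister classes
finite. -/
theorem infinite_reidemeister_of_conj_comp {Γ : Type*} [Group Γ] {φ : Γ →* Γ} (γ : Γ)
    (h : Infinite (Quotient (reidemeisterSetoid ((MulAut.conj γ).toMonoidHom.comp φ)))) :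
    Infinite (Quotient (reidemeisterSetoid φ)) := by
  refine infinite_reidemeister_of_surjective h (F := fun α => α * γ⁻¹) (mul_right_surjective γ⁻¹) ?_
  rintro α _ ⟨δ, rfl⟩
  refine ⟨δ, ?_⟩
  simp [mul_assoc]

theorem infinite_reidemeister_of_mulEquiv {π Γ : Type*} [Group π] [Group Γ] {φ : π →* π}
    (e : π ≃* Γ)
    (h : Infinite (Quotient (reidemeisterSetoid
      ((e.toMonoidHom.comp φ).comp e.symm.toMonoidHom)))) :
    Infinite (Quotient (reidemeisterSetoid φ)) := by
  refine infinite_reidemeister_of_surjective h (F := e) e.surjective ?_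
  rintro α _ ⟨δ, rfl⟩
  refine ⟨e δ, ?_⟩
  simp

/-- If a subgroup of finite index carries a non-trivial `ψ`-invariant homomorphism to `ℝ`, there
are infinitely many Reidemeister classes. -/
theorem infinite_reidemeister_of_invariant_hom {Γ : Type*} [Group Γ] {ψ : Γ →* Γ} {N : Subgroup Γ}
    [N.FiniteIndex] (hψ : ∀ x ∈ N, ψ x ∈ N) {l : Additive N →+ ℝ} (hl0 : l ≠ 0)
    (hl : ∀ x : N, l (Additive.ofMul ⟨ψ x, hψ x x.2⟩) = l (Additive.ofMul x)) :
    Infinite (Quotient (reidemeisterSetoid ψ)) := by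
  classical
  by_contra hfin
  rw [not_infinite_iff_finite] at hfin
  -- One representative per class meeting `N`; the default `1` is never reached for the class of an
  -- element of `N`.
  let r : Quotient (reidemeisterSetoid ψ) → Γ := fun q =>
    if h : ∃ a ∈ N, Quotient.mk _ a = q then h.choose else 1
  have hr : ∀ x : N, ∃ γ, (x : Γ) = γ * r (Quotient.mk _ (x : Γ)) * (ψ γ)⁻¹ := by
    intro x
    have h : ∃ a ∈ N, (Quotient.mk (reidemeisterSetoid ψ) a) = Quotient.mk _ (x : Γ) :=
      ⟨x, x.2, rfl⟩
    have h2 : r (Quotient.mk _ (x : Γ)) = h.choose := dif_pos h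
    rw [h2]
    exact Quotient.exact h.choose_spec.2
  choose c hc using hr
  -- If `x` and `y` share a class and their twisting elements agree modulo `N`, then `x = δ y
  -- ψ(δ)⁻¹` with `δ ∈ N`, and invariance gives `l x = l y`. The inverse of `c x` appears because `Γ
  -- ⧸ N` consists of left cosets.
  let F : N → Quotient (reidemeisterSetoid ψ) × (Γ ⧸ N) := fun x =>
    (Quotient.mk _ (x : Γ), ((c x)⁻¹ : Γ))
  have hfac : Function.FactorsThrough (fun x : N => l (Additive.ofMul x)) F := by
    intro x y hxy
    have h1 : Quotient.mk (reidemeisterSetoid ψ) (x : Γ) = Quotient.mk _ (y : Γ) :=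
      congrArg Prod.fst hxy
    have h2 : (((c x)⁻¹ : Γ) : Γ ⧸ N) = ((c y)⁻¹ : Γ) := congrArg Prod.snd hxy
    rw [QuotientGroup.eq, inv_inv] at h2
    set δ : N := ⟨c x * (c y)⁻¹, h2⟩ with hδ
    have hx : x = δ * y * (⟨ψ δ, hψ δ δ.2⟩ : N)⁻¹ := by
      ext
      rw [Subgroup.coe_mul, Subgroup.coe_mul, Subgroup.coe_inv, hc x, h1]
      nth_rewrite 2 [hc y]
      simp only [hδ, map_mul, map_inv]
      group
    have h3 : l (Additive.ofMul x) = l (Additive.ofMul δ) + l (Additive.ofMul y) -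
        l (Additive.ofMul ⟨ψ δ, hψ δ δ.2⟩) := by
      conv_lhs => rw [hx]
      rw [ofMul_mul, ofMul_mul, ofMul_inv, map_add, map_add, map_neg, sub_eq_add_neg]
    rw [hl] at h3
    dsimp only
    rw [h3]
    ring
  have hrange := Set.finite_range_of_factorsThrough (Set.toFinite _) hfac
  obtain ⟨x, hx⟩ := DFunLike.ne_iff.1 hl0
  rw [AddMonoidHom.zero_apply] at hx
  refine Set.infinite_of_injective_forall_mem (f := fun m : ℕ => (m : ℝ) * l x) ?_ ?_ hrange
  · intro a b hab
    exact_mod_cast mul_right_cancel₀ hx hab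
  · intro m
    refine ⟨(m • x).toMul, ?_⟩
    dsimp only
    rw [ofMul_toMul, map_nsmul, nsmul_eq_mul]

/-- An endomorphism of a finitely generated group fixing an element that survives in some
homomorphism to `ℝ` admits a non-trivial invariant homomorphism to `ℝ`. -/
theorem exists_invariant_hom {N : Type*} [Group N] [Group.FG N] {ψ : N →* N} {t : N}
    (ht : ψ t = t) {l₀ : Additive N →+ ℝ} (hl₀ : l₀ (Additive.ofMul t) ≠ 0) :
    ∃ l : Additive N →+ ℝ, l ≠ 0 ∧
      ∀ x : N, l (Additive.ofMul (ψ x)) = l (Additive.ofMul x) := by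
  obtain ⟨s, hs, hsfin⟩ := Group.fg_iff.1 (inferInstance : Group.FG N)
  have : Finite s := hsfin
  -- Evaluation at finitely many generators is injective, so the space of homomorphisms to `ℝ` is
  -- finite-dimensional.
  let ev : (Additive N →+ ℝ) →ₗ[ℝ] (s → ℝ) :=
    { toFun := fun l x => l (Additive.ofMul (x : N))
      map_add' := fun _ _ => rfl
      map_smul' := fun _ _ => rfl }
  have hev : Function.Injective ev := by
    intro l l' h
    have : l.toMultiplicativeRight = l'.toMultiplicativeRight := by
      refine MonoidHom.eq_of_eqOn_dense hs fun x hx => ?_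
      exact congrArg Multiplicative.ofAdd (congrFun h ⟨x, hx⟩)
    exact AddMonoidHom.toMultiplicativeRight.injective this
  have : FiniteDimensional ℝ (Additive N →+ ℝ) := Module.Finite.of_injective ev hev
  -- Everything in the range of `P` vanishes at the fixed element `t`, but `l₀` does not. So `P` is
  -- not surjective, hence not injective, and its kernel consists of invariant homomorphisms.
  let P : (Additive N →+ ℝ) →ₗ[ℝ] (Additive N →+ ℝ) :=
    { toFun := fun l => l.comp ψ.toAdditive - l
      map_add' := fun a b => by ext; simp; ring
      map_smul' := fun a b => by ext; simp; ring }
  have hns : ¬ Function.Injective P := by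
    rw [LinearMap.injective_iff_surjective]
    intro hsurj
    obtain ⟨l, rfl⟩ := hsurj l₀
    apply hl₀
    change l (Additive.ofMul (ψ t)) - l (Additive.ofMul t) = 0
    rw [ht, sub_self]
  rw [← LinearMap.ker_eq_bot] at hns
  obtain ⟨l, hl, hl0⟩ := Submodule.exists_mem_ne_zero_of_ne_bot hns
  refine ⟨l, hl0, fun x => ?_⟩
  exact sub_eq_zero.1 (DFunLike.congr_fun hl (Additive.ofMul x))

end Reidemeister

/-! ### Euclidean isometries -/

namespace EucIsom

variable {n : ℕ}

theorem mul_apply (γ δ : EucIsom n) (x : Euc n) : (γ * δ) x = γ (δ x) := rfl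

theorem inv_apply_self (γ : EucIsom n) (x : Euc n) : γ⁻¹ (γ x) = x := γ.symm_apply_apply x

theorem apply_eq_linearPart_add (γ : EucIsom n) (x : Euc n) : γ x = linearPart γ x + γ 0 := by
  have := γ.map_vadd 0 x
  rwa [vadd_eq_add, vadd_eq_add, add_zero] at this

theorem norm_apply_sub (γ : EucIsom n) (x y : Euc n) : ‖γ x - γ y‖ = ‖x - y‖ := by
  rw [← dist_eq_norm, ← dist_eq_norm, γ.dist_map]

theorem linearPart_inv_mul_apply (γ δ : EucIsom n) (x : Euc n) :
    ‖linearPart (γ⁻¹ * δ) x - x‖ = ‖linearPart δ x - linearPart γ x‖ := by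
  rw [← (linearPart γ).norm_map (linearPart (γ⁻¹ * δ) x - x), map_sub]
  congr 2
  change (linearPart γ * linearPart (γ⁻¹ * δ)) x = _
  rw [← map_mul, mul_inv_cancel_left]

@[simp]
theorem linearPart_translation (v : Euc n) : linearPart (translation v) = 1 := rfl

theorem translation_injective : Function.Injective (translation : Euc n → EucIsom n) := by
  intro v w h
  have := congrArg (fun γ : EucIsom n => γ 0) h
  simpa using this

theorem eq_translation_of_linearPart_eq_one {γ : EucIsom n} (h : linearPart γ = 1) :
    γ = translation (γ 0) := by
  ext1 x
  rw [apply_eq_linearPart_add, h, translation_apply, add_comm]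
  rfl

/-- An isometry of bounded displacement is a translation. -/
theorem linearPart_eq_one_of_bounded {γ : EucIsom n} {C : ℝ} (h : ∀ x, ‖γ x - x‖ ≤ C) :
    linearPart γ = 1 := by
  ext1 x
  change linearPart γ x = x
  -- At `m x` the displacement is at least `m ‖linearPart γ x - x‖ - ‖γ 0‖`, which is unbounded in
  -- `m` unless the linear part fixes `x`.
  have hm : ∀ m : ℕ, m * ‖linearPart γ x - x‖ ≤ C + ‖γ 0‖ := by
    intro m
    have h1 := h ((m : ℝ) • x)
    rw [apply_eq_linearPart_add, map_smul, add_sub_right_comm, ← smul_sub] at h1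
    have h2 := norm_sub_norm_le ((m : ℝ) • (linearPart γ x - x)) (-γ 0)
    rw [sub_neg_eq_add, norm_neg, norm_smul, Real.norm_natCast] at h2
    linarith
  by_contra hne
  have hpos : 0 < ‖linearPart γ x - x‖ := norm_pos_iff.2 (sub_ne_zero.2 hne)
  obtain ⟨m, hm'⟩ := exists_nat_gt ((C + ‖γ 0‖) / ‖linearPart γ x - x‖)
  rw [div_lt_iff₀ hpos] at hm'
  exact absurd (hm m) (not_le.2 hm')

end EucIsom

/-! ### Geometry of the action of a Bieberbach group -/

namespace IsBieberbach

open EucIsom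

variable {n : ℕ} {Γ : Subgroup (EucIsom n)}

theorem exists_eq_one_of_near (hΓ : IsBieberbach Γ) : ∃ ε > 0, ∀ γ ∈ Γ,
    (∀ x, ‖linearPart γ x - x‖ ≤ ε * ‖x‖) → ‖γ 0‖ ≤ ε → γ = 1 := by
  have := hΓ.discrete
  have hopen : IsOpen ({1} : Set Γ) := isOpen_discrete _
  obtain ⟨U, hU, hU1⟩ := isOpen_induced_iff.1 hopen
  obtain ⟨O, hO, rfl⟩ := isOpen_induced_iff.1 hU
  have h1 : (((linearPart (1 : EucIsom n) : Euc n ≃L[ℝ] Euc n) : Euc n →L[ℝ] Euc n),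
      (1 : EucIsom n) 0) ∈ O := by
    have : (1 : Γ) ∈ ((↑) : Γ → EucIsom n) ⁻¹' ((fun γ : EucIsom n =>
        (((linearPart γ : Euc n ≃L[ℝ] Euc n) : Euc n →L[ℝ] Euc n), γ 0)) ⁻¹' O) := by
      rw [hU1]; rfl
    exact this
  obtain ⟨ε, hε, hball⟩ := Metric.isOpen_iff.1 hO _ h1
  refine ⟨ε / 2, half_pos hε, fun γ hγ hlin h0 => ?_⟩
  have hmem : (⟨γ, hγ⟩ : Γ) ∈ ({1} : Set Γ) := by
    rw [← hU1]
    apply hball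
    rw [Metric.mem_ball, Prod.dist_eq, max_lt_iff]
    constructor
    · refine lt_of_le_of_lt ?_ (half_lt_self hε)
      rw [dist_eq_norm]
      exact ContinuousLinearMap.opNorm_le_bound _ (half_pos hε).le hlin
    · refine lt_of_le_of_lt ?_ (half_lt_self hε)
      rw [dist_eq_norm]
      change ‖γ 0 - 0‖ ≤ _
      rwa [sub_zero]
  exact congrArg Subtype.val hmem

/-- Linear parts have norm at most `1`, so these elements lie in a ball of a finite-dimensional
space, which is totally bounded. Infinitely many of them would include two distinct ones `γ`, `δ` so
close that `γ⁻¹ * δ` is near `1`, contradicting discreteness. -/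
theorem finite_norm_apply_zero_le (hΓ : IsBieberbach Γ) (R : ℝ) :
    {γ | γ ∈ Γ ∧ ‖γ 0‖ ≤ R}.Finite := by
  obtain ⟨ε, hε, hone⟩ := hΓ.exists_eq_one_of_near
  let ι : EucIsom n → (Euc n →L[ℝ] Euc n) × Euc n := fun γ =>
    (((linearPart γ : Euc n ≃L[ℝ] Euc n) : Euc n →L[ℝ] Euc n), γ 0)
  have htb : TotallyBounded (Metric.closedBall (0 : (Euc n →L[ℝ] Euc n) × Euc n) (max 1 R)) :=
    (isCompact_closedBall _ _).totallyBounded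
  obtain ⟨t, ht, hcov⟩ := Metric.totallyBounded_iff.1 htb (ε / 2) (half_pos hε)
  by_contra hinf
  have hmem : ∀ γ ∈ {γ | γ ∈ Γ ∧ ‖γ 0‖ ≤ R}, ∃ y ∈ t, dist (ι γ) y < ε / 2 := by
    rintro γ ⟨-, hγ⟩
    have : ι γ ∈ Metric.closedBall (0 : (Euc n →L[ℝ] Euc n) × Euc n) (max 1 R) := by
      rw [mem_closedBall_zero_iff, Prod.norm_def]
      refine max_le_max ?_ hγ
      refine ContinuousLinearMap.opNorm_le_bound _ zero_le_one fun x => ?_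
      rw [one_mul]
      exact ((linearPart γ).norm_map x).le
    simpa using hcov this
  choose! c hc hcd using hmem
  obtain ⟨γ, hγ, δ, hδ, hne, heq⟩ := Set.Infinite.exists_ne_map_eq_of_mapsTo hinf hc ht
  have hdist : ‖ι δ - ι γ‖ < ε := by
    rw [← dist_eq_norm]
    calc dist (ι δ) (ι γ) ≤ dist (ι δ) (c γ) + dist (ι γ) (c γ) := dist_triangle_right _ _ _
      _ < ε / 2 + ε / 2 := add_lt_add (heq ▸ hcd δ hδ) (hcd γ hγ)
      _ = ε := add_halves ε
  apply hne
  rw [← inv_mul_eq_one]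
  refine hone _ (Γ.mul_mem (Γ.inv_mem hγ.1) hδ.1) (fun x => ?_) ?_
  · rw [linearPart_inv_mul_apply]
    exact ((ι δ - ι γ).1.le_opNorm x).trans
      (mul_le_mul_of_nonneg_right ((norm_fst_le _).trans hdist.le) (norm_nonneg x))
  · have : ‖(γ⁻¹ * δ) 0‖ = ‖(ι δ - ι γ).2‖ := by
      change _ = ‖δ 0 - γ 0‖
      rw [EucIsom.mul_apply, ← norm_apply_sub γ⁻¹ (δ 0) (γ 0), inv_apply_self, sub_zero]
    rw [this]
    exact (norm_snd_le _).trans hdist.le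

theorem norm_apply_zero_le {γ : EucIsom n} {x : Euc n} {r s : ℝ} (hx : ‖x‖ ≤ r)
    (hγx : ‖γ x‖ ≤ s) : ‖γ 0‖ ≤ r + s := by
  have h := norm_apply_sub γ 0 x
  have h2 := norm_sub_norm_le (γ 0) (γ x)
  rw [h, zero_sub, norm_neg] at h2
  linarith

theorem properlyDiscontinuousSMul (hΓ : IsBieberbach Γ) : ProperlyDiscontinuousSMul Γ (Euc n) where
  finite_disjoint_inter_image := by
    intro K L hK hL
    obtain ⟨r, hr⟩ := hK.isBounded.exists_norm_le
    obtain ⟨s, hs⟩ := hL.isBounded.exists_norm_le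
    refine Set.Finite.of_finite_image (f := ((↑) : Γ → EucIsom n))
      ((hΓ.finite_norm_apply_zero_le (r + s)).subset ?_) Subtype.val_injective.injOn
    rintro _ ⟨γ, ⟨_, ⟨x, hx, rfl⟩, hL'⟩, rfl⟩
    exact ⟨γ.2, norm_apply_zero_le (hr x hx) (hs _ hL')⟩

/-- All powers of `γ` fix `x`, so they move `0` by a bounded amount and are finite in number;
torsion-freeness concludes. -/
theorem eq_one_of_apply_eq_self (hΓ : IsBieberbach Γ) {γ : EucIsom n} (hγ : γ ∈ Γ) {x : Euc n}
    (hx : γ x = x) : γ = 1 := by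
  refine hΓ.torsionFree γ hγ ?_
  have hpow : ∀ k : ℕ, (γ ^ k) x = x := by
    intro k
    induction k with
    | zero => rfl
    | succ k ih => rw [pow_succ, EucIsom.mul_apply, hx, ih]
  by_contra hinf
  refine Set.infinite_of_injective_forall_mem (injective_pow_iff_not_isOfFinOrder.2 hinf) ?_
    (hΓ.finite_norm_apply_zero_le (‖x‖ + ‖x‖))
  exact fun k => ⟨Γ.pow_mem hγ k, norm_apply_zero_le le_rfl (by rw [hpow])⟩

theorem isCancelSMul (hΓ : IsBieberbach Γ) : IsCancelSMul Γ (Euc n) := by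
  rw [isCancelSMul_iff_eq_one_of_smul_eq]
  intro γ x h
  exact Subtype.ext (hΓ.eq_one_of_apply_eq_self γ.2 h)

theorem continuousConstSMul (Γ : Subgroup (EucIsom n)) : ContinuousConstSMul Γ (Euc n) where
  continuous_const_smul γ := (γ : EucIsom n).continuous

/-- Every orbit of a Bieberbach group meets a fixed ball. -/
theorem exists_norm_apply_lt (hΓ : IsBieberbach Γ) : ∃ R : ℝ, ∀ x, ∃ γ ∈ Γ, ‖γ x‖ < R := by
  have := hΓ.cocompact
  have := continuousConstSMul Γ
  let p : Euc n → MulAction.orbitRel.Quotient Γ (Euc n) := Quotient.mk _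
  have hp : IsOpenMap p := isOpenMap_quotient_mk'_mul
  obtain ⟨k, hk⟩ := isCompact_univ.elim_directed_cover
    (fun k : ℕ => p '' Metric.ball 0 k) (fun k => hp _ Metric.isOpen_ball)
    (by
      rintro ⟨x⟩ -
      obtain ⟨k, hk⟩ := exists_nat_gt ‖x‖
      exact Set.mem_iUnion.2 ⟨k, x, mem_ball_zero_iff.2 hk, rfl⟩)
    (Monotone.directed_le fun i j hij => Set.image_mono
      (Metric.ball_subset_ball (Nat.cast_le.2 hij)))
  refine ⟨k, fun x => ?_⟩
  obtain ⟨y, hy, hyx⟩ := hk (Set.mem_univ (p x))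
  obtain ⟨γ, hγ⟩ := Quotient.exact hyx
  refine ⟨γ, γ.2, ?_⟩
  have : (γ : EucIsom n) x = y := hγ
  rw [this]
  exact mem_ball_zero_iff.1 hy

/-- A connectedness argument: the ball translates by the subgroup `H` generated by `S`, and those by
its complement, are two open sets covering `ℝⁿ`, so they meet. Where translates by `h` and `g` meet,
`h⁻¹ * g` moves `0` by at most `2R` and thus lies in `S`. -/
theorem fg (hΓ : IsBieberbach Γ) : Group.FG Γ := by
  obtain ⟨R, hR⟩ := hΓ.exists_norm_apply_lt
  let S : Set Γ := {γ | ‖(γ : EucIsom n) 0‖ ≤ R + R}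
  have hS : S.Finite := Set.Finite.of_finite_image (f := ((↑) : Γ → EucIsom n))
    ((hΓ.finite_norm_apply_zero_le (R + R)).subset
      (by rintro _ ⟨γ, hγ, rfl⟩; exact ⟨γ.2, hγ⟩)) Subtype.val_injective.injOn
  let H := Subgroup.closure S
  refine Group.fg_iff.2 ⟨S, ?_, hS⟩
  change H = ⊤
  by_contra hne
  obtain ⟨γ₀, hγ₀⟩ : ∃ γ, γ ∉ H := by
    by_contra hall
    push Not at hall
    exact hne (eq_top_iff.2 fun γ _ => hall γ)
  let U (T : Set Γ) : Set (Euc n) := ⋃ γ ∈ T, (γ : EucIsom n) '' Metric.ball 0 R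
  have hU : ∀ T, IsOpen (U T) := fun T => isOpen_biUnion fun γ _ =>
    (γ : EucIsom n).toHomeomorph.isOpenMap _ Metric.isOpen_ball
  have hcov : (Set.univ : Set (Euc n)) ⊆ U H ∪ U (H : Set Γ)ᶜ := by
    intro x _
    obtain ⟨γ, hγ, hx⟩ := hR x
    have hmem : x ∈ ((⟨γ, hγ⟩⁻¹ : Γ) : EucIsom n) '' Metric.ball 0 R :=
      ⟨γ x, mem_ball_zero_iff.2 hx, inv_apply_self γ x⟩
    by_cases h : (⟨γ, hγ⟩⁻¹ : Γ) ∈ H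
    · exact Or.inl (Set.mem_biUnion h hmem)
    · exact Or.inr (Set.mem_biUnion h hmem)
  obtain ⟨γ₁, -, hγ₁⟩ := hR 0
  obtain ⟨x, -, hx1, hx2⟩ := isPreconnected_univ (α := Euc n) (U H) (U (H : Set Γ)ᶜ) (hU _) (hU _)
    hcov
    ⟨γ₁ 0, trivial, Set.mem_biUnion H.one_mem ⟨γ₁ 0, mem_ball_zero_iff.2 hγ₁, rfl⟩⟩
    ⟨(γ₀ : EucIsom n) (γ₁ 0), trivial,
      Set.mem_biUnion hγ₀ ⟨γ₁ 0, mem_ball_zero_iff.2 hγ₁, rfl⟩⟩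
  obtain ⟨h, hh, b, hb, rfl⟩ := Set.mem_iUnion₂.1 hx1
  obtain ⟨g, hg, b', hb', hbb⟩ := Set.mem_iUnion₂.1 hx2
  apply hg
  have hmem : h⁻¹ * g ∈ H := by
    refine Subgroup.subset_closure ?_
    refine norm_apply_zero_le (mem_ball_zero_iff.1 hb').le ?_
    have : ((h⁻¹ * g : Γ) : EucIsom n) b' = b := by
      change (h : EucIsom n)⁻¹ ((g : EucIsom n) b') = b
      rw [hbb, inv_apply_self]
    rw [this]
    exact (mem_ball_zero_iff.1 hb).le
  have := H.mul_mem hh hmem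
  rwa [mul_inv_cancel_left] at this

/-- An element with finitely many conjugates is a translation. -/
theorem linearPart_eq_one_of_finite_conj (hΓ : IsBieberbach Γ) {γ : Γ}
    (h : (Set.range fun δ : Γ => δ * γ * δ⁻¹).Finite) : linearPart (γ : EucIsom n) = 1 := by
  obtain ⟨R, hR⟩ := hΓ.exists_norm_apply_lt
  obtain ⟨C, hC⟩ := (h.image fun α : Γ => ‖(α : EucIsom n) 0‖).bddAbove
  refine linearPart_eq_one_of_bounded (C := C + R + R) fun x => ?_
  -- The displacement of `γ` at `x` equals that of `δ γ δ⁻¹` at `δ x`. With `δ x` in the ball of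
  -- radius `R` and the finitely many conjugates moving `0` by at most `C`, it is at most `C + 2R`.
  obtain ⟨δ, hδ, hx⟩ := hR x
  have h1 : ‖(δ * γ * δ⁻¹) 0‖ ≤ C := hC ⟨_, ⟨⟨δ, hδ⟩, rfl⟩, rfl⟩
  have h2 : (δ * γ * δ⁻¹) (δ x) = δ ((γ : EucIsom n) x) := by
    rw [EucIsom.mul_apply, EucIsom.mul_apply, inv_apply_self]
  have h3 := norm_apply_sub (δ * (γ : EucIsom n) * δ⁻¹) (δ x) 0
  rw [sub_zero] at h3
  rw [← norm_apply_sub δ, ← h2]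
  have h4 := norm_sub_le ((δ * γ * δ⁻¹) (δ x)) (δ x)
  have h5 := norm_sub_norm_le ((δ * γ * δ⁻¹) (δ x)) ((δ * γ * δ⁻¹) 0)
  linarith

end IsBieberbach

namespace Bieberbach

open EucIsom

variable {n : ℕ} {Γ : Subgroup (EucIsom n)}

theorem finite_norm_le_lattice (hΓ : IsBieberbach Γ) (R : ℝ) :
    {v : lattice Γ | ‖(v : Euc n)‖ ≤ R}.Finite := by
  refine Set.Finite.of_finite_image (f := fun v : lattice Γ => translation (v : Euc n))
    ((hΓ.finite_norm_apply_zero_le R).subset ?_)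
    (translation_injective.comp Subtype.val_injective).injOn
  rintro _ ⟨v, hv, rfl⟩
  refine ⟨v.2, ?_⟩
  rw [translation_apply, add_zero]
  exact hv

theorem finite_lattice (hΓ : IsBieberbach Γ) : Module.Finite ℤ (lattice Γ) := by
  have hdisc : DiscreteTopology (lattice Γ) := by
    refine discreteTopology_of_isOpen_singleton_zero ?_
    have hfin := finite_norm_le_lattice hΓ 1
    have h : ({0} : Set (lattice Γ)) =
        Metric.ball 0 1 \ ({v : lattice Γ | ‖(v : Euc n)‖ ≤ 1} \ {0}) := by
      ext v
      simp only [Set.mem_singleton_iff, Set.mem_sdiff, mem_ball_zero_iff, Set.mem_ofPred_eq, not_and,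
        not_not]
      refine ⟨?_, fun h => h.2 h.1.le⟩
      rintro rfl
      simp
    rw [h]
    exact Metric.isOpen_ball.sdiff (hfin.subset Set.sdiff_subset).isClosed
  have : DiscreteTopology (AddSubgroup.toIntSubmodule (lattice Γ)) := hdisc
  exact instModuleFinite_of_discrete_submodule (AddSubgroup.toIntSubmodule (lattice Γ))

end Bieberbach

/-! ### Passage from the manifold to its fundamental group -/

namespace FundamentalGroup

theorem map_bijective_of_homeomorph {X Y : Type*} [TopologicalSpace X] [TopologicalSpace Y]
    (f : X ≃ₜ Y) (x : X) :
    Function.Bijective (FundamentalGroup.map (f : C(X, Y)) x) := by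
  constructor
  · rintro ⟨P⟩ ⟨Q⟩ h
    have h1 : Path.Homotopic (P.map f.continuous) (Q.map f.continuous) := Quotient.exact h
    obtain ⟨H⟩ := h1
    refine Quotient.sound ?_
    have h2 := ContinuousMap.HomotopicRel.comp_continuousMap ⟨H⟩ (f.symm : C(Y, X))
    have key : ∀ R : Path x x, (f.symm : C(Y, X)).comp (R.map f.continuous).toContinuousMap =
        R.toContinuousMap := fun R => by
      ext t
      exact f.symm_apply_apply (R t)
    rw [key, key] at h2
    exact h2
  · rintro ⟨Q⟩
    let P : Path x x :=
      { toFun := fun t => f.symm (Q t)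
        continuous_toFun := f.symm.continuous.comp Q.continuous
        source' := by rw [Q.source]; exact f.symm_apply_apply x
        target' := by rw [Q.target]; exact f.symm_apply_apply x }
    refine ⟨Quotient.mk _ P, ?_⟩
    refine congrArg (Quotient.mk _) ?_
    ext t
    exact f.apply_symm_apply (Q t)

end FundamentalGroup

theorem inducedEnd_bijective {M : Type*} [TopologicalSpace M] (f : M ≃ₜ M) (x : M)
    (w : Path (f x) x) : Function.Bijective (inducedEnd (f : C(M, M)) x w) :=
  (FundamentalGroup.fundamentalGroupMulEquivOfPath w).bijective.comp
    (FundamentalGroup.map_bijective_of_homeomorph f x)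

/-- The fundamental group of a flat manifold `ℝⁿ / Γ` is isomorphic to `Γ`. -/
theorem IsBieberbach.nonempty_fundamentalGroup_mulEquiv {n : ℕ} {Γ : Subgroup (EucIsom n)}
    (hΓ : IsBieberbach Γ) {M : Type*} [TopologicalSpace M]
    (h : M ≃ₜ MulAction.orbitRel.Quotient Γ (Euc n)) (x : M) :
    Nonempty (FundamentalGroup M x ≃* Γ) := by
  have := hΓ.properlyDiscontinuousSMul
  have := hΓ.isCancelSMul
  have := IsBieberbach.continuousConstSMul Γ
  have hq : IsQuotientCoveringMap (Quotient.mk (MulAction.orbitRel Γ (Euc n))) Γ :=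
    isQuotientCoveringMap_quotientMk_of_properlyDiscontinuousSMul
  have hp := hq.homeomorph_comp h.symm
  obtain ⟨e, he⟩ := hp.surjective x
  -- The covering identifies the fundamental group with the opposite group of `Γ`; inversion removes
  -- the opposite.
  exact ⟨(hp.fundamentalGroupEquiv (x := x) ⟨e, he⟩).trans (MulEquiv.inv' Γ).symm⟩

/-! ### The lattice and its rational holonomy -/

namespace Bieberbach

open EucIsom
open scoped TensorProduct

variable {n : ℕ} {Γ : Subgroup (EucIsom n)}

/-- The translation in `Γ` given by a lattice vector. -/
noncomputable def latticeTranslation (v : lattice Γ) : Γ := ⟨translation (v : Euc n), v.2⟩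

theorem latticeTranslation_injective :
    Function.Injective (latticeTranslation : lattice Γ → Γ) := fun _ _ h =>
  Subtype.ext (translation_injective (congrArg Subtype.val h))

theorem latticeTranslation_add (v w : lattice Γ) :
    latticeTranslation (v + w) = latticeTranslation v * latticeTranslation w := by
  ext x
  change ((v : Euc n) + w + x) _ = ((v : Euc n) + (w + x)) _
  rw [add_assoc]

/-- The element of the holonomy group given by an element of `Γ`. -/
noncomputable def holonomy (Γ : Subgroup (EucIsom n)) : Γ →* holonomyGroup Γ :=
  (linearPart : EucIsom n →* _).subgroupMap Γ

theorem holonomy_surjective (Γ : Subgroup (EucIsom n)) : Function.Surjective (holonomy Γ) :=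
  MonoidHom.subgroupMap_surjective _ _

theorem latticeTranslation_conj (γ : Γ) (v : lattice Γ) :
    latticeTranslation (holonomyRep Γ (holonomy Γ γ) v) = γ * latticeTranslation v * γ⁻¹ :=
  Subtype.ext (holonomyRep_conj Γ γ γ.2 v)

theorem norm_holonomyRep (g : holonomyGroup Γ) (v : lattice Γ) :
    ‖(holonomyRep Γ g v : Euc n)‖ = ‖(v : Euc n)‖ :=
  (g : Euc n ≃ₗᵢ[ℝ] Euc n).norm_map v

/-- Conjugation acts on translation vectors by isometries, and only finitely many lattice vectors
have a given length. -/
theorem finite_conj_latticeTranslation (hΓ : IsBieberbach Γ) (v : lattice Γ) :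
    (Set.range fun δ : Γ => δ * latticeTranslation v * δ⁻¹).Finite := by
  refine ((finite_norm_le_lattice hΓ ‖(v : Euc n)‖).image latticeTranslation).subset ?_
  rintro _ ⟨δ, rfl⟩
  exact ⟨holonomyRep Γ (holonomy Γ δ) v, (norm_holonomyRep (holonomy Γ δ) v).le,
    latticeTranslation_conj δ v⟩

theorem exists_eq_latticeTranslation (hΓ : IsBieberbach Γ) {γ : Γ}
    (h : (Set.range fun δ : Γ => δ * γ * δ⁻¹).Finite) : ∃ v, γ = latticeTranslation v := by
  have h1 := eq_translation_of_linearPart_eq_one (hΓ.linearPart_eq_one_of_finite_conj h)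
  exact ⟨⟨(γ : EucIsom n) 0, show translation _ ∈ Γ from h1 ▸ γ.2⟩, Subtype.ext h1⟩

theorem exists_apply_latticeTranslation (hΓ : IsBieberbach Γ) (φ : Γ ≃* Γ) (v : lattice Γ) :
    ∃ w, φ (latticeTranslation v) = latticeTranslation w := by
  refine exists_eq_latticeTranslation hΓ (((finite_conj_latticeTranslation hΓ v).image φ).subset ?_)
  rintro _ ⟨δ, rfl⟩
  exact ⟨_, ⟨φ.symm δ, rfl⟩, by simp⟩

/-- The translation subgroup is characteristic: an automorphism of `Γ` restricts to the lattice. -/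
theorem exists_latticeEquiv (hΓ : IsBieberbach Γ) (φ : Γ ≃* Γ) : ∃ a : lattice Γ ≃+ lattice Γ,
    ∀ v, φ (latticeTranslation v) = latticeTranslation (a v) := by
  choose a ha using exists_apply_latticeTranslation hΓ φ
  choose b hb using exists_apply_latticeTranslation hΓ φ.symm
  refine ⟨⟨⟨a, b, fun v => ?_, fun v => ?_⟩, fun v w => ?_⟩, ha⟩
  · apply latticeTranslation_injective
    rw [← hb, ← ha, φ.symm_apply_apply]
  · apply latticeTranslation_injective
    rw [← ha, ← hb, φ.apply_symm_apply]
  · apply latticeTranslation_injective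
    change latticeTranslation (a (v + w)) = latticeTranslation (a v + a w)
    rw [← ha, latticeTranslation_add, map_mul, ha, ha, latticeTranslation_add]

/-- The rational holonomy representation of `Γ` as a homomorphism to the group of linear
automorphisms. -/
noncomputable def rationalHolonomyHom (Γ : Subgroup (EucIsom n)) :
    Γ →* (ℚ ⊗[ℤ] lattice Γ ≃ₗ[ℚ] ℚ ⊗[ℤ] lattice Γ) :=
  ((LinearMap.GeneralLinearGroup.generalLinearEquiv ℚ _).toMonoidHom.comp
    (MonoidHom.toHomUnits (rationalHolonomyRep Γ))).comp (holonomy Γ)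

theorem rationalHolonomyHom_apply (γ : Γ) (u : ℚ ⊗[ℤ] lattice Γ) :
    rationalHolonomyHom Γ γ u = rationalHolonomyRep Γ (holonomy Γ γ) u := rfl

theorem rationalHolonomyHom_tmul (γ : Γ) (q : ℚ) (v : lattice Γ) :
    rationalHolonomyHom Γ γ (q ⊗ₜ v) = q ⊗ₜ holonomyRep Γ (holonomy Γ γ) v := rfl

/-- The holonomy action is determined on finitely many lattice generators and preserves their
lengths, leaving finitely many images for each. -/
theorem finite_range_rationalHolonomyHom (hΓ : IsBieberbach Γ) :
    (Set.range (rationalHolonomyHom Γ)).Finite := by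
  have := finite_lattice hΓ
  obtain ⟨s, hs⟩ := (Module.Finite.fg_top : (⊤ : Submodule ℤ (lattice Γ)).FG)
  let F : Γ → s → lattice Γ := fun γ v => holonomyRep Γ (holonomy Γ γ) v
  have hF : (Set.range F).Finite := by
    refine (Set.Finite.pi' fun v : s =>
      finite_norm_le_lattice hΓ ‖((v : lattice Γ) : Euc n)‖).subset ?_
    rintro _ ⟨γ, rfl⟩ v
    exact (norm_holonomyRep (holonomy Γ γ) v).le
  refine Set.finite_range_of_factorsThrough hF fun γ δ h => ?_
  have h1 : holonomyRep Γ (holonomy Γ γ) = holonomyRep Γ (holonomy Γ δ) :=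
    LinearMap.ext_on hs fun v hv => congrFun h ⟨v, hv⟩
  ext u
  rw [rationalHolonomyHom_apply, rationalHolonomyHom_apply]
  exact congrArg (fun f => LinearMap.baseChange ℚ f u) h1

theorem isSolvable_range_rationalHolonomyHom
    (h : Group.IsSolvable (holonomyGroup Γ)) : Group.IsSolvable (rationalHolonomyHom Γ).range := by
  let f := (LinearMap.GeneralLinearGroup.generalLinearEquiv ℚ _).toMonoidHom.comp
    (MonoidHom.toHomUnits (rationalHolonomyRep Γ))
  have hr : (rationalHolonomyHom Γ).range = f.range := by
    ext x
    constructor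
    · rintro ⟨γ, rfl⟩
      exact ⟨holonomy Γ γ, rfl⟩
    · rintro ⟨g, rfl⟩
      obtain ⟨γ, rfl⟩ := holonomy_surjective Γ g
      exact ⟨γ, rfl⟩
  rw [hr]
  exact Group.isSolvable_of_surjective f.rangeRestrict_surjective

/-- The lattice inside its rationalization. -/
noncomputable def latticeRange (Γ : Subgroup (EucIsom n)) : Submodule ℤ (ℚ ⊗[ℤ] lattice Γ) :=
  LinearMap.range (TensorProduct.mk ℤ ℚ (lattice Γ) 1).toAddMonoidHom.toIntLinearMap

theorem tmul_mem_latticeRange (v : lattice Γ) : (1 : ℚ) ⊗ₜ[ℤ] v ∈ latticeRange Γ := ⟨v, rfl⟩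

theorem fg_latticeRange (hΓ : IsBieberbach Γ) : (latticeRange Γ).FG := by
  have := finite_lattice hΓ
  rw [latticeRange, LinearMap.range_eq_map]
  exact Submodule.FG.map _ Module.Finite.fg_top

theorem exists_zsmul_mem_latticeRange (u : ℚ ⊗[ℤ] lattice Γ) :
    ∃ m : ℤ, m ≠ 0 ∧ m • u ∈ latticeRange Γ := by
  induction u using TensorProduct.induction_on with
  | zero => exact ⟨1, one_ne_zero, by rw [smul_zero]; exact Submodule.zero_mem _⟩
  | tmul q v =>
    refine ⟨q.den, by exact_mod_cast q.den_ne_zero, q.num • v, ?_⟩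
    change (1 : ℚ) ⊗ₜ[ℤ] (q.num • v) = _
    rw [TensorProduct.tmul_smul, TensorProduct.smul_tmul',
      TensorProduct.smul_tmul']
    congr 1
    rw [zsmul_eq_mul, zsmul_eq_mul, mul_one, Int.cast_natCast, Rat.den_mul_eq_num]
  | add a b iha ihb =>
    obtain ⟨k, hk, hka⟩ := iha
    obtain ⟨l, hl, hlb⟩ := ihb
    refine ⟨k * l, mul_ne_zero hk hl, ?_⟩
    rw [smul_add]
    refine Submodule.add_mem _ ?_ ?_
    · rw [mul_comm, mul_smul]
      exact Submodule.smul_mem _ _ hka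
    · rw [mul_smul]
      exact Submodule.smul_mem _ _ hlb

/-- The lattice is torsion-free inside a real vector space, hence flat over `ℤ`, so the injection of
`ℤ` into `ℚ` remains injective after tensoring. -/
theorem tmul_injective :
    Function.Injective fun v : lattice Γ => (1 : ℚ) ⊗ₜ[ℤ] v := by
  have : IsAddTorsionFree (Euc n) := .of_module_rat (Euc n)
  have : IsAddTorsionFree (lattice Γ) :=
    Function.Injective.isAddTorsionFree (lattice Γ).subtype Subtype.val_injective
  have : Module.IsTorsionFree ℤ (lattice Γ) := inferInstance
  have : Module.Flat ℤ (lattice Γ) := Module.Flat.flat_iff_torsion_eq_bot_of_isBezout.2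
    (Submodule.isTorsionFree_iff_torsion_eq_bot.1 inferInstance)
  exact Module.Flat.tensorProduct_mk_injective (R := ℤ) (lattice Γ) ℚ

/-- An element of `Γ` acting trivially on the lattice fixes every lattice vector. -/
theorem linearPart_apply_of_mem_ker {γ : Γ} (h : γ ∈ (rationalHolonomyHom Γ).ker)
    (v : lattice Γ) : linearPart (γ : EucIsom n) v = (v : Euc n) := by
  have h1 : rationalHolonomyHom Γ γ ((1 : ℚ) ⊗ₜ v) = (1 : ℚ) ⊗ₜ v := by
    rw [MonoidHom.mem_ker.1 h]; rfl
  rw [rationalHolonomyHom_tmul] at h1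
  exact congrArg Subtype.val (tmul_injective h1)

/-- If an automorphism of `Γ` fixes a non-trivial translation, it has infinitely many Reidemeister
classes. -/
theorem infinite_reidemeister_of_apply_eq_self (hΓ : IsBieberbach Γ) {ψ : Γ →* Γ}
    (hψ : ∀ γ ∈ (rationalHolonomyHom Γ).ker, ψ γ ∈ (rationalHolonomyHom Γ).ker)
    {v : lattice Γ} (hv : v ≠ 0) (hfix : ψ (latticeTranslation v) = latticeTranslation v) :
    Infinite (Quotient (reidemeisterSetoid ψ)) := by
  set N := (rationalHolonomyHom Γ).ker with hN
  have : Finite (rationalHolonomyHom Γ).range := finite_range_rationalHolonomyHom hΓ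
  have : N.FiniteIndex := Subgroup.finiteIndex_ker _
  have := hΓ.fg
  have : Group.FG N := inferInstance
  -- Pairing the value at `0` with `v` is additive on `N`, since linear parts there are orthogonal
  -- and fix `v`. On the translation by `v` it equals `‖v‖²`.
  let l₀ : Additive N →+ ℝ :=
    { toFun := fun γ => inner ℝ (((γ.toMul : Γ) : EucIsom n) 0) (v : Euc n)
      map_zero' := inner_zero_left _
      map_add' := fun γ δ => by
        have h : (((γ + δ).toMul : Γ) : EucIsom n) 0 =
            ((γ.toMul : Γ) : EucIsom n) (((δ.toMul : Γ) : EucIsom n) 0) := rfl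
        rw [h, apply_eq_linearPart_add, inner_add_left]
        have h2 := (linearPart ((γ.toMul : Γ) : EucIsom n)).inner_map_map
          (((δ.toMul : Γ) : EucIsom n) 0) (v : Euc n)
        rw [linearPart_apply_of_mem_ker γ.toMul.2] at h2
        rw [h2, add_comm] }
  have hmem : latticeTranslation v ∈ N := by
    rw [hN, MonoidHom.mem_ker]
    have h1 : holonomy Γ (latticeTranslation v) = 1 := Subtype.ext (linearPart_translation _)
    ext u
    rw [rationalHolonomyHom_apply, h1, map_one]
    rfl
  obtain ⟨l, hl0, hl⟩ := exists_invariant_hom (ψ := ψ.restrict hψ) (t := ⟨latticeTranslation v, hmem⟩) (Subtype.ext hfix) (l₀ := l₀) (by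
      have : l₀ (Additive.ofMul ⟨latticeTranslation v, hmem⟩) =
          inner ℝ ((v : Euc n) + 0) (v : Euc n) := rfl
      rw [this, add_zero, real_inner_self_eq_norm_sq]
      exact pow_ne_zero 2 (norm_ne_zero_iff.2 fun h => hv (Subtype.ext h)))
  exact infinite_reidemeister_of_invariant_hom hψ hl0 hl

end Bieberbach

theorem Subrepresentation.isIrreducibleOn {G V : Type*} [Group G] [AddCommGroup V] [Module ℚ V]
    {ρ : Representation ℚ G V} (ρ' : Subrepresentation ρ) (h : ρ'.toRepresentation.IsIrreducible)
    {K : Subgroup (V ≃ₗ[ℚ] V)} (hK : ∀ k ∈ K, ∃ g, ∀ v, k v = ρ g v)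
    (hK' : ∀ g, ∃ k ∈ K, ∀ v, k v = ρ g v) :
    LinearEquiv.IsIrreducibleOn K ρ'.toSubmodule := by
  refine ⟨fun k hk u hu => ?_, fun W hW hinv => ?_⟩
  · obtain ⟨g, hg⟩ := hK k hk
    rw [hg]
    exact ρ'.apply_mem_toSubmodule g hu
  · let σ : Subrepresentation ρ'.toRepresentation :=
      { toSubmodule := W.comap ρ'.toSubmodule.subtype
        apply_mem_toSubmodule := fun g v hv => by
          obtain ⟨k, hk, hkg⟩ := hK' g
          have := hinv k hk v hv
          rw [hkg] at this
          exact this }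
    rcases h.eq_bot_or_eq_top σ with h0 | h1
    · left
      rw [eq_bot_iff]
      intro w hw
      have : (⟨w, hW hw⟩ : ρ'.toSubmodule) ∈ σ := hw
      rw [h0] at this
      exact congrArg Subtype.val ((Submodule.mem_bot ℚ).1 this)
    · right
      refine le_antisymm hW fun u hu => ?_
      have : (⟨u, hu⟩ : ρ'.toSubmodule) ∈ σ := by rw [h1]; exact Submodule.mem_top
      exact this

/-- A subrepresentation whose image is not conjugate to that of any other subrepresentation is
preserved by every automorphism normalizing the image of the representation. -/
theorem Subrepresentation.apply_mem_of_not_imagesConjugate {k G V : Type*} [Field k] [Group G]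
    [AddCommGroup V] [Module k V] {ρ : Representation k G V} (ρ' : Subrepresentation ρ)
    (hconj : ∀ σ : Subrepresentation ρ, σ ≠ ρ' →
      ¬ ρ'.toRepresentation.ImagesConjugate σ.toRepresentation)
    {A : V ≃ₗ[k] V} (h : ∀ g, ∃ g', ∀ v, A (ρ g v) = ρ g' (A v))
    (h' : ∀ g', ∃ g, ∀ v, A (ρ g v) = ρ g' (A v)) {u : V} (hu : u ∈ ρ'.toSubmodule) :
    A u ∈ ρ'.toSubmodule := by
  -- The restriction of `A` conjugates the image of `ρ'` onto the image of `σ`, so the hypothesis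
  -- leaves only `σ = ρ'`.
  let σ : Subrepresentation ρ :=
    { toSubmodule := ρ'.toSubmodule.map (A : V →ₗ[k] V)
      apply_mem_toSubmodule := by
        rintro g' _ ⟨v, hv, rfl⟩
        obtain ⟨g, hg⟩ := h' g'
        exact ⟨ρ g v, ρ'.apply_mem_toSubmodule g hv, hg v⟩ }
  have hσ : σ = ρ' := by
    by_contra hne
    refine hconj σ hne ⟨A.submoduleMap ρ'.toSubmodule, ?_⟩
    have key : ∀ g g', (∀ v, A (ρ g v) = ρ g' (A v)) →
        (A.submoduleMap ρ'.toSubmodule).conj (ρ'.toRepresentation g) = σ.toRepresentation g' := by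
      intro g g' hgg
      ext x
      obtain ⟨y, rfl⟩ := (A.submoduleMap ρ'.toSubmodule).surjective x
      rw [LinearEquiv.conj_apply_apply, LinearEquiv.symm_apply_apply]
      exact hgg y
    ext f
    constructor
    · rintro ⟨_, ⟨g, rfl⟩, rfl⟩
      obtain ⟨g', hg'⟩ := h g
      exact ⟨g', (key g g' hg').symm⟩
    · rintro ⟨g', rfl⟩
      obtain ⟨g, hg⟩ := h' g'
      exact ⟨_, ⟨g, rfl⟩, key g g' hg⟩
  have : A u ∈ σ.toSubmodule := ⟨u, hu, rfl⟩
  rwa [hσ] at this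

/-! ### Assembly of the proof -/

namespace Bieberbach

open EucIsom
open scoped TensorProduct

variable {n : ℕ} {Γ : Subgroup (EucIsom n)}

/-- Every automorphism of a Bieberbach group satisfying the hypotheses on the holonomy
representation has infinitely many Reidemeister classes. -/
theorem infinite_reidemeister (hΓ : IsBieberbach Γ)
    (hsolv : Group.IsSolvable (holonomyGroup Γ))
    (ρ' : Subrepresentation (rationalHolonomyRep Γ))
    (hirr : ρ'.toRepresentation.IsIrreducible)
    (hodd : Odd (Module.finrank ℚ ρ'.toSubmodule))
    (hnontriv : ∃ g, ρ'.toRepresentation g ≠ 1)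
    (hconj : ∀ σ : Subrepresentation (rationalHolonomyRep Γ), σ ≠ ρ' →
      ¬ ρ'.toRepresentation.ImagesConjugate σ.toRepresentation)
    (φ : Γ ≃* Γ) : Infinite (Quotient (reidemeisterSetoid φ.toMonoidHom)) := by
  have := finite_lattice hΓ
  obtain ⟨a, ha⟩ := exists_latticeEquiv hΓ φ
  let A : ℚ ⊗[ℤ] lattice Γ ≃ₗ[ℚ] ℚ ⊗[ℤ] lattice Γ :=
    TensorProduct.AlgebraTensorModule.congr (LinearEquiv.refl ℚ ℚ) a.toIntLinearEquiv
  have hAt : ∀ (q : ℚ) (v : lattice Γ), A (q ⊗ₜ v) = q ⊗ₜ a v := fun _ _ => rfl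
  have hAγ : ∀ (γ : Γ) (u : ℚ ⊗[ℤ] lattice Γ),
      A (rationalHolonomyHom Γ γ u) = rationalHolonomyHom Γ (φ γ) (A u) := by
    intro γ u
    induction u using TensorProduct.induction_on with
    | zero => simp only [map_zero]
    | tmul q v =>
      rw [rationalHolonomyHom_tmul, hAt, hAt, rationalHolonomyHom_tmul]
      congr 1
      apply latticeTranslation_injective
      rw [← ha, latticeTranslation_conj, latticeTranslation_conj, map_mul, map_mul, map_inv, ha]
    | add x y hx hy => simp only [map_add, hx, hy]
  have hconjA : ∀ γ : Γ, A * rationalHolonomyHom Γ γ * A⁻¹ = rationalHolonomyHom Γ (φ γ) := by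
    intro γ
    rw [mul_inv_eq_iff_eq_mul]
    ext u
    exact hAγ γ u
  set K := (rationalHolonomyHom Γ).range with hK
  have : Finite K := finite_range_rationalHolonomyHom hΓ
  have : Group.IsSolvable K := isSolvable_range_rationalHolonomyHom hsolv
  have hrep : ∀ g, ∃ γ, ∀ u, rationalHolonomyHom Γ γ u = rationalHolonomyRep Γ g u := by
    intro g
    obtain ⟨γ, rfl⟩ := holonomy_surjective Γ g
    exact ⟨γ, fun _ => rfl⟩
  have hAU : ∀ u ∈ ρ'.toSubmodule, A u ∈ ρ'.toSubmodule := by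
    refine fun u hu => ρ'.apply_mem_of_not_imagesConjugate hconj (fun g => ?_) (fun g => ?_) hu
    · obtain ⟨γ, rfl⟩ := holonomy_surjective Γ g
      exact ⟨holonomy Γ (φ γ), fun v => hAγ γ v⟩
    · obtain ⟨γ, rfl⟩ := holonomy_surjective Γ g
      refine ⟨holonomy Γ (φ.symm γ), fun v => ?_⟩
      have := hAγ (φ.symm γ) v
      rwa [φ.apply_symm_apply] at this
  have hirrOn : LinearEquiv.IsIrreducibleOn K ρ'.toSubmodule :=
    ρ'.isIrreducibleOn hirr
      (by rintro _ ⟨γ, rfl⟩; exact ⟨holonomy Γ γ, fun _ => rfl⟩)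
      (fun g => by
        obtain ⟨γ, hγ⟩ := hrep g
        exact ⟨_, ⟨γ, rfl⟩, hγ⟩)
  have hnt : ∃ k ∈ K, ∃ u ∈ ρ'.toSubmodule, k u ≠ u := by
    by_contra hno
    push Not at hno
    obtain ⟨g, hg⟩ := hnontriv
    apply hg
    obtain ⟨γ, hγ⟩ := hrep g
    ext u
    exact (hγ u).symm.trans (hno _ ⟨γ, rfl⟩ u u.2)
  obtain ⟨_, ⟨γ, rfl⟩, u, -, hu0, hfix⟩ := LinearEquiv.exists_mul_apply_eq_self
    (fg_latticeRange hΓ) exists_zsmul_mem_latticeRange hirrOn hodd hnt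
    (by rintro _ ⟨γ, rfl⟩ _ ⟨v, rfl⟩; exact tmul_mem_latticeRange _) hAU
    (by rintro _ ⟨γ, rfl⟩; exact ⟨φ γ, (hconjA γ).symm⟩)
    (by rintro _ ⟨v, rfl⟩; exact tmul_mem_latticeRange _)
    (by rintro _ ⟨v, rfl⟩; exact tmul_mem_latticeRange (a.symm v))
  -- Clearing denominators turns the rational fixed vector into a lattice vector `v`; the
  -- translation by `v` is then fixed by `φ` followed by conjugation by `γ`.
  obtain ⟨m, hm, v, hv⟩ := exists_zsmul_mem_latticeRange u
  change (1 : ℚ) ⊗ₜ[ℤ] v = m • u at hv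
  have hv0 : v ≠ 0 := by
    rintro rfl
    rw [TensorProduct.tmul_zero, ← Int.cast_smul_eq_zsmul ℚ] at hv
    exact smul_ne_zero (Int.cast_ne_zero.2 hm) hu0 hv.symm
  have hfixv : holonomyRep Γ (holonomy Γ γ) (a v) = v := by
    apply tmul_injective
    change rationalHolonomyHom Γ γ (A (1 ⊗ₜ v)) = 1 ⊗ₜ v
    rw [hv, map_zsmul, map_zsmul, hfix]
  refine infinite_reidemeister_of_conj_comp γ
    (infinite_reidemeister_of_apply_eq_self hΓ (fun δ hδ => ?_) hv0 ?_)
  · have : φ δ ∈ (rationalHolonomyHom Γ).ker := by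
      rw [MonoidHom.mem_ker, ← hconjA, MonoidHom.mem_ker.1 hδ, mul_one, mul_inv_cancel]
    exact (inferInstance : (rationalHolonomyHom Γ).ker.Normal).conj_mem _ this γ
  · change γ * φ (latticeTranslation v) * γ⁻¹ = _
    rw [ha, ← latticeTranslation_conj, hfixv]

end Bieberbach

theorem mainTheorem2 (n : ℕ) (Γ : Subgroup (EucIsom n)) (hΓ : IsBieberbach Γ)
    (M : Type*) [TopologicalSpace M]
    (hM : Nonempty (M ≃ₜ MulAction.orbitRel.Quotient Γ (Euc n)))
    (hsolv : Group.IsSolvable (Bieberbach.holonomyGroup Γ))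
    (ρ' : Subrepresentation (Bieberbach.rationalHolonomyRep Γ))
    (hirr : ρ'.toRepresentation.IsIrreducible)
    (hodd : Odd (Module.finrank ℚ ρ'.toSubmodule))
    (hnontriv : ∃ g, ρ'.toRepresentation g ≠ 1)
    (hconj : ∀ σ : Subrepresentation (Bieberbach.rationalHolonomyRep Γ), σ ≠ ρ' →
      ¬ ρ'.toRepresentation.ImagesConjugate σ.toRepresentation) :
    HasRInfinity M := by
  intro f x w
  obtain ⟨h⟩ := hM
  obtain ⟨e⟩ := hΓ.nonempty_fundamentalGroup_mulEquiv h x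
  let F : FundamentalGroup M x ≃* FundamentalGroup M x :=
    MulEquiv.ofBijective (inducedEnd (f : C(M, M)) x w) (inducedEnd_bijective f x w)
  have : Infinite (Quotient (reidemeisterSetoid (inducedEnd (f : C(M, M)) x w))) :=
    infinite_reidemeister_of_mulEquiv e
      (Bieberbach.infinite_reidemeister hΓ hsolv ρ' hirr hodd hnontriv hconj
        ((e.symm.trans F).trans e))
  exact ENat.card_eq_top_of_infinite
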